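/- **Syntax.** Fix a set of constructors $c,d,\dots$ and, disjoint from it, an infinite set of variables $x,y,\dots$. Terms and case bindings of the $\lambda$-calculus with constructors are $$t,u ::= x \mid \lambda x.t \mid t\,u \mid c \mid \theta\cdot t \mid \maltese ,\qquad \theta ::= \{c_1\mapsto u_1;\dots;c_n\mapsto u_n\}\quad(n\ge 0,\ c_i \text{ pairwise distinct}),$$ up to renaming of bound variables; $\theta\cdot t$ is the case construct, $\maltese$ is the Daimon, and $\mathrm{dom}(\theta)=\{c_1,\dots,c_n\}$. **Reduction.** The calculus $\lambda C^-$ (all rules except CaseCase) has as reduction $\to$ the contextual closure (under $\lambda$, on both sides of applications, in the argument of a case construct and in the branches of case bindings) of - AppLam: $(\lambda x.t)u\to t\{x\leftarrow u\}$; AppDai: $\maltese\,u\to\maltese$; - LamApp: $\lambda x.t\,x\to t$ ($x$ not free in $t$); LamDai: $\lambda x.\maltese\to\maltese$; - CaseCons: $\theta\cdot c\to t$ if $(c\mapsto t)\in\theta$; CaseDai: $\theta\cdot\maltese\to\maltese$; - CaseApp: $\theta\cdot(t\,u)\to(\theta\cdot t)\,u$; CaseLam: $\theta\cdot\lambda x.t\to\lambda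 x.(\theta\cdot t)$ ($x$ not free in $\theta$). A term is *strongly normalising* if it starts no infinite reduction, *defined* if it has no subterm of the form $\theta\cdot c$ with $c\notin\mathrm{dom}(\theta)$ (a match failure), *hereditarily defined* if all its reducts (in any number $\ge 0$ of steps) are defined, and *perfectly normalising* if it is both strongly normalising and hereditarily defined. **Types.** There are ordinary type variables $X$ and data type variables $\alpha$; $\nu$ stands for a variable of either kind. Types $T,U$ and the subclass of data types $D,E$ are $$T,U ::= X\mid\alpha\mid \mathbf c\mid D\,T\mid T\to U\mid T\cup U\mid T\cap U\mid\forall\nu.T\mid\exists\nu.T,$$ $$D,E ::= \alpha\mid\mathbf c\mid D\,T\mid D\cup E\mid D\cap E\mid\forall\nu.D\mid\exists\nu.D,$$ with one type constant $\mathbf c$ for each constructor $c$, up to renaming of bound type variables. For $\vec T=T_1,\dots,T_k$ ($k\ge0$), $\mathbf c\vec T=(\cdots(\mathbf c\,T_1)\cdots)T_k$ and $\vec T\to U=T_1\to\cdots\to T_k\to U$. $TV$ denotes the set of free type variables. $\bigcap_i$ and $\bigcup_i$ are intersections and unions of non-empty finite families. **Sub-typing** $\le$ is the least relation on types that is reflexive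 and transitive and satisfies: - $T\to U\le T'\to U'$ if $T'\le T$ and $U\le U'$; $\;D\,T\le D'\,T'$ if $D\le D'$ and $T\le T'$; - $U_i\le U_1\cup U_2$ ($i=1,2$); $\;T_1\cup T_2\le U$ if $T_1\le U$ and $T_2\le U$; $\;U_1\cap U_2\le U_i$ ($i=1,2$); $\;T\le U_1\cap U_2$ if $T\le U_1$ and $T\le U_2$; - $T\le\forall\nu.U$ if $T\le U$ and $\nu\notin TV(T)$; $\;\forall X.T\le T\{X\leftarrow U\}$; $\;\forall\alpha.T\le T\{\alpha\leftarrow D\}$; - $\exists\nu.U\le T$ if $U\le T$ and $\nu\notin TV(T)$; $\;T\{X\leftarrow U\}\le\exists X.T$; $\;T\{\alpha\leftarrow D\}\le\exists\alpha.T$; - $D\le T\to D\,T$; $\;\mathbf c_1\vec T\cap\mathbf c_2\vec U\le\forall\alpha.\alpha$ if $c_1\ne c_2$; - $\bigcap_i D_iT_i\le(\bigcap_iD_i)(\bigcap_iT_i)$; $\;\forall\nu.(D\,T)\le(\forall\nu.D)(\forall\nu.T)$; - $\bigcap_i(T_i\to U_i)\le(\bigcap_iT_i)\to(\bigcap_iU_i)$;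 $\;\forall\nu.(T\to U)\le(\forall\nu.T)\to(\forall\nu.U)$; - $\bigcap_i(T_i\to U_i)\le(\bigcup_iT_i)\to(\bigcup_iU_i)$; $\;\forall\nu.(T\to U)\le(\exists\nu.T)\to(\exists\nu.U)$; - $D(\bigcup_iT_i)\le\bigcup_iD\,T_i$; $\;(\bigcup_iD_i)T\le\bigcup_iD_iT$; - $D(\exists\nu.T)\le\exists\nu.D\,T$ if $\nu\notin TV(D)$; $\;(\exists\nu.D)T\le\exists\nu.D\,T$ if $\nu\notin TV(T)$; - $\forall\nu.(T\cup U)\le(\forall\nu.T)\cup U$ and $(\exists\nu.T)\cap U\le\exists\nu.(T\cap U)$ if $\nu\notin TV(U)$. **Typing.** A context $\Gamma$ is a finite list of declarations $x:T$ with distinct variables, whose order is irrelevant. The judgements $\Gamma\vdash M:T$, where $M$ is a term or a case binding, are generated by the following rules. - Cb: if $\theta=\{c_i\mapsto u_i\mid 1\le i\le n\}$ and $\Gamma\vdash u_i:\vec U_i\to T_i$ for all $i$, then $\Gamma\vdash\theta:\mathbf c_{j}\vec U_{j}\to T_{j}$ for each $1\le j\le n$. Cb$_\bot$: if $\Gamma\vdash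 u_i:T_i$ for all $i$ ($n\ge0$), then $\Gamma\vdash\theta:(\forall\alpha.\alpha)\to\forall X.X$. - Init: $\Gamma\vdash x:T$ if $(x:T)\in\Gamma$. False: $\Gamma\vdash\maltese:T$. Constr: $\Gamma\vdash c:\mathbf c$. - $\to$intro: from $\Gamma,x:T\vdash t:U$ infer $\Gamma\vdash\lambda x.t:T\to U$. $\to$elim: from $\Gamma\vdash t:T\to U$ and $\Gamma\vdash u:T$ infer $\Gamma\vdash t\,u:U$. - Case: from $\Gamma\vdash t:\vec U\to T$ and $\Gamma\vdash\theta:T\to T'$ infer $\Gamma\vdash\theta\cdot t:\vec U\to T'$. - Univ: from $\Gamma\vdash M:T$ infer $\Gamma\vdash M:\forall\nu.T$ if $\nu\notin TV(\Gamma)$. Inter: from $\Gamma\vdash M:T$ and $\Gamma\vdash M:U$ infer $\Gamma\vdash M:T\cap U$. - Exist: from $\Gamma,x:T\vdash M:U$ infer $\Gamma,x:\exists\nu.T\vdash M:U$ if $\nu\notin TV(\Gamma)\cup TV(U)$. Union: from $\Gamma,x:T_1\vdash M:U$ and $\Gamma,x:T_2\vdash M:U$ infer $\Gamma,x:T_1\cup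 T_2\vdash M:U$. - Subs: from $\Gamma\vdash M:T$ and $T\le U$ infer $\Gamma\vdash M:U$. **Theorem.** Every well typed term is perfectly normalising for $\lambda C^-$: if $\Gamma\vdash t:T$ for some context $\Gamma$ and some type $T$, then $t$ is strongly normalising and hereditarily defined for $\to$. -/

import Mathlib

namespace LamC

universe u

/-! # Terms

Variables are de Bruijn indices, so terms are taken up to renaming of bound variables. `C` is the
set of constructors. A case binding is a finite function from constructors to terms, given by its
domain `s : Finset C` together with a function `θ` on `s`. -/

/-- Terms of the lambda-calculus with constructors: variables, abstraction, application,
constructors, the case construct `{θ}·t`, and the Daimon. -/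
inductive Tm (C : Type u) : Type u
  | var (n : ℕ) : Tm C
  | lam (t : Tm C) : Tm C
  | app (t v : Tm C) : Tm C
  | con (c : C) : Tm C
  | cas (s : Finset C) (θ : {c // c ∈ s} → Tm C) (t : Tm C) : Tm C
  | dai : Tm C

namespace Tm

variable {C : Type u}

/-- The renaming `ξ` pushed under one binder. -/
def upRen (ξ : ℕ → ℕ) : ℕ → ℕ
  | 0 => 0
  | n + 1 => ξ n + 1

/-- Renaming of the free variables. -/
def rename : (ℕ → ℕ) → Tm C → Tm C
  | ξ, var n => var (ξ n)
  | ξ, lam t => lam (rename (upRen ξ) t)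
  | ξ, app t v => app (rename ξ t) (rename ξ v)
  | _, con c => con c
  | ξ, cas s θ t => cas s (fun c => rename ξ (θ c)) (rename ξ t)
  | _, dai => dai

/-- Weakening by one fresh variable (which gets the index `0`). -/
def lift (t : Tm C) : Tm C := rename Nat.succ t

/-- The substitution `σ` pushed under one binder. -/
def upSubst (σ : ℕ → Tm C) : ℕ → Tm C
  | 0 => var 0
  | n + 1 => lift (σ n)

/-- Simultaneous capture-avoiding substitution. -/
def subst : (ℕ → Tm C) → Tm C → Tm C
  | σ, var n => σ n
  | σ, lam t => lam (subst (upSubst σ) t)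
  | σ, app t v => app (subst σ t) (subst σ v)
  | _, con c => con c
  | σ, cas s θ t => cas s (fun c => subst σ (θ c)) (subst σ t)
  | _, dai => dai

/-- The substitution sending variable `0` to `v` and lowering the other variables by one. -/
def single (v : Tm C) : ℕ → Tm C
  | 0 => v
  | n + 1 => var n

/-- `t{x ← v}` where `x` is the variable with index `0` in `t`. -/
def inst (t v : Tm C) : Tm C := subst (single v) t

end Tm

/-! # Reduction -/

/-- One step of reduction: the contextual closure of all the rules of the calculus other than
the composition rule between two case constructs. A case binding reduces by reducing exactly one of
its branches. -/
inductive Step {C : Type u} : Tm C → Tm C → Prop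
  | appLam (t v : Tm C) : Step (.app (.lam t) v) (t.inst v)
  | appDai (v : Tm C) : Step (.app .dai v) .dai
  | lamApp (t : Tm C) : Step (.lam (.app t.lift (.var 0))) t
  | lamDai : Step (.lam .dai) .dai
  | caseCons (s : Finset C) (θ : {c // c ∈ s} → Tm C) (c : {c // c ∈ s}) :
      Step (.cas s θ (.con c)) (θ c)
  | caseDai (s : Finset C) (θ : {c // c ∈ s} → Tm C) : Step (.cas s θ .dai) .dai
  | caseApp (s : Finset C) (θ : {c // c ∈ s} → Tm C) (t v : Tm C) :
      Step (.cas s θ (.app t v)) (.app (.cas s θ t) v)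
  | caseLam (s : Finset C) (θ : {c // c ∈ s} → Tm C) (t : Tm C) :
      Step (.cas s θ (.lam t)) (.lam (.cas s (fun c => (θ c).lift) t))
  | lamCongr {t t' : Tm C} : Step t t' → Step (.lam t) (.lam t')
  | appCongrLeft {t t' : Tm C} (v : Tm C) : Step t t' → Step (.app t v) (.app t' v)
  | appCongrRight (t : Tm C) {v v' : Tm C} : Step v v' → Step (.app t v) (.app t v')
  | caseCongrArg (s : Finset C) (θ : {c // c ∈ s} → Tm C) {t t' : Tm C} :
      Step t t' → Step (.cas s θ t) (.cas s θ t')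
  | caseCongrBranch (s : Finset C) (θ θ' : {c // c ∈ s} → Tm C) (t : Tm C) (c : {c // c ∈ s}) :
      Step (θ c) (θ' c) → (∀ d, d ≠ c → θ' d = θ d) → Step (.cas s θ t) (.cas s θ' t)

/-- Reduction in any number of steps. -/
def Reduces {C : Type u} : Tm C → Tm C → Prop := Relation.ReflTransGen Step

/-- There is no infinite reduction starting from `t`. -/
def StronglyNormalising {C : Type u} (t : Tm C) : Prop :=
  ¬ ∃ f : ℕ → Tm C, f 0 = t ∧ ∀ n, Step (f n) (f (n + 1))

/-- `Subterm r t`: the term `r` occurs in `t` (the branches of case bindings included). -/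
inductive Subterm {C : Type u} : Tm C → Tm C → Prop
  | refl (t : Tm C) : Subterm t t
  | lam {r t : Tm C} : Subterm r t → Subterm r (.lam t)
  | appLeft {r t : Tm C} (v : Tm C) : Subterm r t → Subterm r (.app t v)
  | appRight {r : Tm C} (t : Tm C) {v : Tm C} : Subterm r v → Subterm r (.app t v)
  | caseArg {r : Tm C} (s : Finset C) (θ : {c // c ∈ s} → Tm C) {t : Tm C} :
      Subterm r t → Subterm r (.cas s θ t)
  | caseBranch {r : Tm C} (s : Finset C) (θ : {c // c ∈ s} → Tm C) (t : Tm C)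
      (c : {c // c ∈ s}) : Subterm r (θ c) → Subterm r (.cas s θ t)

/-- A term is defined when it contains no match failure `{θ}·c` with `c` outside of the domain
of `θ`. -/
def Defined {C : Type u} (t : Tm C) : Prop :=
  ∀ (s : Finset C) (θ : {c // c ∈ s} → Tm C) (c : C), Subterm (.cas s θ (.con c)) t → c ∈ s

/-- All the reducts of `t` (in any number of steps) are defined. -/
def HereditarilyDefined {C : Type u} (t : Tm C) : Prop := ∀ v, Reduces t v → Defined v

/-- Strongly normalising and hereditarily defined. -/
def PerfectlyNormalising {C : Type u} (t : Tm C) : Prop :=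
  StronglyNormalising t ∧ HereditarilyDefined t

/-! # Types

There are two spaces of type variables: ordinary ones (`X`) and data type variables (`α`). Each has
its own de Bruijn indices: an index of kind `k` counts the quantifiers of kind `k`. -/

/-- The two kinds of type variables, and the two syntactic classes of types. -/
inductive Kind : Type
  | ord
  | data
  deriving DecidableEq

/-- Raw types. The restriction of the left-hand side of a type application to data types is
imposed by `HasKind`. -/
inductive Ty (C : Type u) : Type u
  | var (k : Kind) (n : ℕ) : Ty C
  | con (c : C) : Ty C
  | app (D T : Ty C) : Ty C
  | arrow (T U : Ty C) : Ty C
  | union (T U : Ty C) : Ty C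
  | inter (T U : Ty C) : Ty C
  | all (k : Kind) (T : Ty C) : Ty C
  | ex (k : Kind) (T : Ty C) : Ty C

/-- The grammar of types: `HasKind .ord T` says that `T` is a type, and `HasKind .data D` that `D`
is a data type. -/
inductive HasKind {C : Type u} : Kind → Ty C → Prop
  | var (k : Kind) (n : ℕ) : HasKind k (.var k n)
  | ofData {D : Ty C} : HasKind .data D → HasKind .ord D
  | con (c : C) : HasKind .data (.con c)
  | app {D T : Ty C} : HasKind .data D → HasKind .ord T → HasKind .data (.app D T)
  | arrow {T U : Ty C} : HasKind .ord T → HasKind .ord U → HasKind .ord (.arrow T U)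
  | union {k : Kind} {T U : Ty C} : HasKind k T → HasKind k U → HasKind k (.union T U)
  | inter {k : Kind} {T U : Ty C} : HasKind k T → HasKind k U → HasKind k (.inter T U)
  | all {k : Kind} (j : Kind) {T : Ty C} : HasKind k T → HasKind k (.all j T)
  | ex {k : Kind} (j : Kind) {T : Ty C} : HasKind k T → HasKind k (.ex j T)

/-- `T` is a (well formed) type. -/
abbrev IsType {C : Type u} (T : Ty C) : Prop := HasKind .ord T

/-- `D` is a data type. -/
abbrev IsData {C : Type u} (D : Ty C) : Prop := HasKind .data D

namespace Ty

variable {C : Type u}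

/-- The renaming `ξ` pushed under a quantifier of kind `k`. -/
def upRen (k : Kind) (ξ : Kind → ℕ → ℕ) : Kind → ℕ → ℕ := fun j n =>
  if j = k then
    match n with
    | 0 => 0
    | m + 1 => ξ j m + 1
  else ξ j n

/-- Renaming of the free type variables. -/
def rename : (Kind → ℕ → ℕ) → Ty C → Ty C
  | ξ, var k n => var k (ξ k n)
  | _, con c => con c
  | ξ, app D T => app (rename ξ D) (rename ξ T)
  | ξ, arrow T U => arrow (rename ξ T) (rename ξ U)
  | ξ, union T U => union (rename ξ T) (rename ξ U)
  | ξ, inter T U => inter (rename ξ T) (rename ξ U)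
  | ξ, all k T => all k (rename (upRen k ξ) T)
  | ξ, ex k T => ex k (rename (upRen k ξ) T)

/-- Weakening by one fresh type variable `ν` of kind `k` (which gets the index `0`). A type in
which `ν` does not occur free is exactly one of the form `lift k T`. -/
def lift (k : Kind) (T : Ty C) : Ty C := rename (fun j n => if j = k then n + 1 else n) T

/-- The substitution `σ` pushed under a quantifier of kind `k`. -/
def upSubst (k : Kind) (σ : Kind → ℕ → Ty C) : Kind → ℕ → Ty C := fun j n =>
  if j = k then
    match n with
    | 0 => var j 0
    | m + 1 => lift k (σ j m)
  else lift k (σ j n)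

/-- Simultaneous capture-avoiding substitution of types for type variables. -/
def subst : (Kind → ℕ → Ty C) → Ty C → Ty C
  | σ, var k n => σ k n
  | _, con c => con c
  | σ, app D T => app (subst σ D) (subst σ T)
  | σ, arrow T U => arrow (subst σ T) (subst σ U)
  | σ, union T U => union (subst σ T) (subst σ U)
  | σ, inter T U => inter (subst σ T) (subst σ U)
  | σ, all k T => all k (subst (upSubst k σ) T)
  | σ, ex k T => ex k (subst (upSubst k σ) T)

/-- The substitution of `U` for the variable of kind `k` and index `0`. -/
def single (k : Kind) (U : Ty C) : Kind → ℕ → Ty C := fun j n =>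
  if j = k then
    match n with
    | 0 => U
    | m + 1 => var j m
  else var j n

/-- `T{ν ← U}` where `ν` is the variable of kind `k` with index `0` in `T`. -/
def inst (k : Kind) (T U : Ty C) : Ty C := subst (single k U) T

/-- `U₁ → ⋯ → Uₙ → T`. -/
def arrows (Us : List (Ty C)) (T : Ty C) : Ty C := Us.foldr arrow T

/-- `c U₁ ⋯ Uₙ`, the iterated application of the type constant of a constructor `c`. -/
def conApps (c : C) (Us : List (Ty C)) : Ty C := Us.foldl app (con c)

/-- The intersection of a non-empty finite family of types. -/
def bigInter : (n : ℕ) → (Fin (n + 1) → Ty C) → Ty C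
  | 0, T => T 0
  | n + 1, T => inter (T 0) (bigInter n fun i => T i.succ)

/-- The union of a non-empty finite family of types. -/
def bigUnion : (n : ℕ) → (Fin (n + 1) → Ty C) → Ty C
  | 0, T => T 0
  | n + 1, T => union (T 0) (bigUnion n fun i => T i.succ)

end Ty

/-! # Sub-typing

A side condition that `ν` is not free in a type is expressed by weakening that type with `lift`.
The premises `IsType`, `IsData` and `HasKind` make sure that only well formed types are related. -/

/-- The sub-typing relation. -/
inductive Sub {C : Type u} : Ty C → Ty C → Prop
  | refl {T : Ty C} : IsType T → Sub T T
  | trans {T V U : Ty C} : Sub T V → Sub V U → Sub T U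
  | arrow {T T' U U' : Ty C} : Sub T' T → Sub U U' → Sub (.arrow T U) (.arrow T' U')
  | app {D D' T T' : Ty C} : IsData D → IsData D' → Sub D D' → Sub T T' →
      Sub (.app D T) (.app D' T')
  | unionIntroL {U₁ U₂ : Ty C} : IsType U₁ → IsType U₂ → Sub U₁ (.union U₁ U₂)
  | unionIntroR {U₁ U₂ : Ty C} : IsType U₁ → IsType U₂ → Sub U₂ (.union U₁ U₂)
  | unionElim {T₁ T₂ U : Ty C} : Sub T₁ U → Sub T₂ U → Sub (.union T₁ T₂) U
  | interIntro {T U₁ U₂ : Ty C} : Sub T U₁ → Sub T U₂ → Sub T (.inter U₁ U₂)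
  | interElimL {U₁ U₂ : Ty C} : IsType U₁ → IsType U₂ → Sub (.inter U₁ U₂) U₁
  | interElimR {U₁ U₂ : Ty C} : IsType U₁ → IsType U₂ → Sub (.inter U₁ U₂) U₂
  | allIntro (k : Kind) {T U : Ty C} : Sub (T.lift k) U → Sub T (.all k U)
  | allElim (k : Kind) {T U : Ty C} : IsType T → HasKind k U → Sub (.all k T) (T.inst k U)
  | exIntro (k : Kind) {T U : Ty C} : IsType T → HasKind k U → Sub (T.inst k U) (.ex k T)
  | exElim (k : Kind) {T U : Ty C} : Sub U (T.lift k) → Sub (.ex k U) T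
  | data {D T : Ty C} : IsData D → IsType T → Sub D (.arrow T (.app D T))
  | constr {c₁ c₂ : C} {Ts Us : List (Ty C)} : c₁ ≠ c₂ →
      (∀ T ∈ Ts, IsType T) → (∀ U ∈ Us, IsType U) →
      Sub (.inter (.conApps c₁ Ts) (.conApps c₂ Us)) (.all .data (.var .data 0))
  | appInter (n : ℕ) {D T : Fin (n + 1) → Ty C} : (∀ i, IsData (D i)) → (∀ i, IsType (T i)) →
      Sub (.bigInter n fun i => .app (D i) (T i)) (.app (.bigInter n D) (.bigInter n T))
  | appAll (k : Kind) {D T : Ty C} : IsData D → IsType T →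
      Sub (.all k (.app D T)) (.app (.all k D) (.all k T))
  | arrowInter (n : ℕ) {T U : Fin (n + 1) → Ty C} : (∀ i, IsType (T i)) → (∀ i, IsType (U i)) →
      Sub (.bigInter n fun i => .arrow (T i) (U i)) (.arrow (.bigInter n T) (.bigInter n U))
  | arrowAll (k : Kind) {T U : Ty C} : IsType T → IsType U →
      Sub (.all k (.arrow T U)) (.arrow (.all k T) (.all k U))
  | arrowUnion (n : ℕ) {T U : Fin (n + 1) → Ty C} : (∀ i, IsType (T i)) → (∀ i, IsType (U i)) →
      Sub (.bigInter n fun i => .arrow (T i) (U i)) (.arrow (.bigUnion n T) (.bigUnion n U))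
  | arrowEx (k : Kind) {T U : Ty C} : IsType T → IsType U →
      Sub (.all k (.arrow T U)) (.arrow (.ex k T) (.ex k U))
  | unionAppR (n : ℕ) {D : Ty C} {T : Fin (n + 1) → Ty C} : IsData D → (∀ i, IsType (T i)) →
      Sub (.app D (.bigUnion n T)) (.bigUnion n fun i => .app D (T i))
  | unionAppL (n : ℕ) {D : Fin (n + 1) → Ty C} {T : Ty C} : (∀ i, IsData (D i)) → IsType T →
      Sub (.app (.bigUnion n D) T) (.bigUnion n fun i => .app (D i) T)
  | exAppR (k : Kind) {D T : Ty C} : IsData D → IsType T →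
      Sub (.app D (.ex k T)) (.ex k (.app (D.lift k) T))
  | exAppL (k : Kind) {D T : Ty C} : IsData D → IsType T →
      Sub (.app (.ex k D) T) (.ex k (.app D (T.lift k)))
  | unionAll (k : Kind) {T U : Ty C} : IsType T → IsType U →
      Sub (.all k (.union T (U.lift k))) (.union (.all k T) U)
  | exInter (k : Kind) {T U : Ty C} : IsType T → IsType U →
      Sub (.inter (.ex k T) U) (.ex k (.inter T (U.lift k)))

/-! # Typing -/

/-- The subjects of typing judgements: terms and case bindings. -/
inductive Subject (C : Type u) : Type u
  | tm (t : Tm C) : Subject C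
  | cb (s : Finset C) (θ : {c // c ∈ s} → Tm C) : Subject C

/-- Typing contexts; the entry at position `n` is the type of the variable `n`. -/
abbrev Ctx (C : Type u) : Type u := List (Ty C)

/-- Weakening of a context by one fresh type variable of kind `k`. -/
def Ctx.lift {C : Type u} (k : Kind) (Γ : Ctx C) : Ctx C := List.map (Ty.lift k) Γ

/-- All the types of the context are well formed. -/
def Ctx.WF {C : Type u} (Γ : Ctx C) : Prop := ∀ T ∈ Γ, IsType T

/-- The typing judgement `Γ ⊢ M : T`, for `M` a term or a case binding. In `exist` and `union` the
variable whose declaration is changed may stand anywhere in the context. -/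
inductive Typed {C : Type u} : Ctx C → Subject C → Ty C → Prop
  | cb {Γ : Ctx C} {s : Finset C} {θ : {c // c ∈ s} → Tm C}
      (Us : {c // c ∈ s} → List (Ty C)) (Ts : {c // c ∈ s} → Ty C) (c₀ : {c // c ∈ s}) :
      (∀ c, Typed Γ (.tm (θ c)) (.arrows (Us c) (Ts c))) →
      Typed Γ (.cb s θ) (.arrow (.conApps c₀ (Us c₀)) (Ts c₀))
  | cbBot {Γ : Ctx C} {s : Finset C} {θ : {c // c ∈ s} → Tm C} (Ts : {c // c ∈ s} → Ty C) :
      Γ.WF → (∀ c, Typed Γ (.tm (θ c)) (Ts c)) →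
      Typed Γ (.cb s θ) (.arrow (.all .data (.var .data 0)) (.all .ord (.var .ord 0)))
  | init {Γ : Ctx C} {n : ℕ} {T : Ty C} : Γ.WF → Γ[n]? = some T → Typed Γ (.tm (.var n)) T
  | false {Γ : Ctx C} {T : Ty C} : Γ.WF → IsType T → Typed Γ (.tm .dai) T
  | constr {Γ : Ctx C} (c : C) : Γ.WF → Typed Γ (.tm (.con c)) (.con c)
  | arrowIntro {Γ : Ctx C} {t : Tm C} {T U : Ty C} :
      Typed (T :: Γ) (.tm t) U → Typed Γ (.tm (.lam t)) (.arrow T U)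
  | arrowElim {Γ : Ctx C} {t v : Tm C} {T U : Ty C} :
      Typed Γ (.tm t) (.arrow T U) → Typed Γ (.tm v) T → Typed Γ (.tm (.app t v)) U
  | case {Γ : Ctx C} {t : Tm C} {s : Finset C} {θ : {c // c ∈ s} → Tm C} {T T' : Ty C}
      (Us : List (Ty C)) :
      Typed Γ (.tm t) (.arrows Us T) → Typed Γ (.cb s θ) (.arrow T T') →
      Typed Γ (.tm (.cas s θ t)) (.arrows Us T')
  | univ {Γ : Ctx C} {M : Subject C} (k : Kind) {T : Ty C} :
      Typed (Γ.lift k) M T → Typed Γ M (.all k T)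
  | inter {Γ : Ctx C} {M : Subject C} {T U : Ty C} :
      Typed Γ M T → Typed Γ M U → Typed Γ M (.inter T U)
  | exist {Γ Δ : Ctx C} {M : Subject C} (k : Kind) {T U : Ty C} :
      Typed (Γ.lift k ++ T :: Δ.lift k) M (U.lift k) → Typed (Γ ++ .ex k T :: Δ) M U
  | union {Γ Δ : Ctx C} {M : Subject C} {T₁ T₂ U : Ty C} :
      Typed (Γ ++ T₁ :: Δ) M U → Typed (Γ ++ T₂ :: Δ) M U → Typed (Γ ++ .union T₁ T₂ :: Δ) M U
  | subs {Γ : Ctx C} {M : Subject C} {T U : Ty C} : Typed Γ M T → Sub T U → Typed Γ M U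

end LamC

/-! The proof is by reducibility, after two adjustments. First, a match failure is made to reduce to
itself (`LStep.caseFail`). A term that is strongly normalising for this larger relation can never
reach a match failure, since such a subterm would make the whole reduct loop. Plain strong
normalisation (`SN`) thus gives both halves of the conclusion (`SN.perfectlyNormalising`).

Secondly, types are interpreted by sets whose closure conditions each concern one term and its
deterministic weak head reduction `Wh` (`Saturated`). Such conditions survive arbitrary non-empty
unions, so unions and existentials are plain unions and their elimination rules are immediate. The
strategy always moves a case construct inside an application before evaluating that application.
This lets a function type pass through a case construct, as the typing rule for case requires. The
price is that `Wh` is not a congruence under case; `Wh.cas_join` repairs this with a common reduct.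

The set `bot` holds the normalising terms that evaluate to the Daimon or to a variable-headed term;
it is the least candidate. Data types contain, besides `bot`, only terms evaluating to a constructor
applied to arguments. By determinism that value is unique, which validates the sub-typing rules on
type application.

The technical core is weak head expansion: `Wh.project` yields `SN.app_of_wh` and `SN.cas_of_wh`.
Soundness is `Sub.interp_subset` for sub-typing and `Typed.mem_interp` for typing. -/

namespace LamC

/-! ### Substitution calculus -/

namespace Tm

variable {C : Type*}

theorem upRen_comp (ζ ξ : ℕ → ℕ) : upRen ζ ∘ upRen ξ = upRen (ζ ∘ ξ) := by
  funext n; cases n <;> rfl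

theorem rename_rename (t : Tm C) (ζ ξ : ℕ → ℕ) :
    (t.rename ξ).rename ζ = t.rename (ζ ∘ ξ) := by
  induction t generalizing ζ ξ with
  | var n => rfl
  | con c => rfl
  | dai => rfl
  | lam t ih => simp [rename, ih, upRen_comp]
  | app t v iht ihv => simp [rename, iht, ihv]
  | cas s θ t ihθ iht => simp [rename, iht, ihθ]

theorem upSubst_comp_upRen (σ : ℕ → Tm C) (ξ : ℕ → ℕ) :
    upSubst σ ∘ upRen ξ = upSubst (σ ∘ ξ) := by
  funext n; cases n <;> rfl

theorem subst_rename (t : Tm C) (σ : ℕ → Tm C) (ξ : ℕ → ℕ) :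
    (t.rename ξ).subst σ = t.subst (σ ∘ ξ) := by
  induction t generalizing σ ξ with
  | var n => rfl
  | con c => rfl
  | dai => rfl
  | lam t ih => simp [rename, subst, ih, upSubst_comp_upRen]
  | app t v iht ihv => simp [rename, subst, iht, ihv]
  | cas s θ t ihθ iht => simp [rename, subst, iht, ihθ]

theorem rename_upSubst (σ : ℕ → Tm C) (ξ : ℕ → ℕ) :
    (fun n => (upSubst σ n).rename (upRen ξ)) = upSubst fun n => (σ n).rename ξ := by
  funext n
  cases n with
  | zero => rfl
  | succ n => simp only [upSubst, lift, rename_rename]; rfl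

theorem rename_subst (t : Tm C) (σ : ℕ → Tm C) (ξ : ℕ → ℕ) :
    (t.subst σ).rename ξ = t.subst fun n => (σ n).rename ξ := by
  induction t generalizing σ ξ with
  | var n => rfl
  | con c => rfl
  | dai => rfl
  | lam t ih => simp [rename, subst, ih, rename_upSubst]
  | app t v iht ihv => simp [rename, subst, iht, ihv]
  | cas s θ t ihθ iht => simp [rename, subst, iht, ihθ]

theorem lift_subst_upSubst (t : Tm C) (σ : ℕ → Tm C) :
    t.lift.subst (upSubst σ) = (t.subst σ).lift := by
  simp only [lift, subst_rename, rename_subst]; rfl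

theorem subst_upSubst (σ τ : ℕ → Tm C) :
    (fun n => (upSubst σ n).subst (upSubst τ)) = upSubst fun n => (σ n).subst τ := by
  funext n
  cases n with
  | zero => rfl
  | succ n => exact lift_subst_upSubst _ _

theorem subst_subst (t : Tm C) (σ τ : ℕ → Tm C) :
    (t.subst σ).subst τ = t.subst fun n => (σ n).subst τ := by
  induction t generalizing σ τ with
  | var n => rfl
  | con c => rfl
  | dai => rfl
  | lam t ih => simp [subst, ih, subst_upSubst]
  | app t v iht ihv => simp [subst, iht, ihv]
  | cas s θ t ihθ iht => simp [subst, iht, ihθ]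

theorem upSubst_var : upSubst (var : ℕ → Tm C) = var := by
  funext n; cases n <;> rfl

theorem subst_var (t : Tm C) : t.subst var = t := by
  induction t with
  | var n => rfl
  | con c => rfl
  | dai => rfl
  | lam t ih => simp [subst, upSubst_var, ih]
  | app t v iht ihv => simp [subst, iht, ihv]
  | cas s θ t ihθ iht => simp [subst, iht, ihθ]

theorem upSubst_var_comp (ξ : ℕ → ℕ) : upSubst ((var : ℕ → Tm C) ∘ ξ) = var ∘ upRen ξ := by
  funext n; cases n <;> rfl

theorem rename_eq_subst (t : Tm C) (ξ : ℕ → ℕ) : t.rename ξ = t.subst (var ∘ ξ) := by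
  induction t generalizing ξ with
  | var n => rfl
  | con c => rfl
  | dai => rfl
  | lam t ih => simp [rename, subst, upSubst_var_comp, ih]
  | app t v iht ihv => simp [rename, subst, iht, ihv]
  | cas s θ t ihθ iht => simp [rename, subst, iht, ihθ]

@[simp] theorem lift_inst (t v : Tm C) : t.lift.inst v = t := by
  simp only [lift, inst, subst_rename]
  exact subst_var t

theorem subst_inst (t v : Tm C) (σ : ℕ → Tm C) :
    (t.inst v).subst σ = (t.subst (upSubst σ)).inst (v.subst σ) := by
  simp only [inst, subst_subst]
  congr 1
  funext n
  cases n with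
  | zero => rfl
  | succ n => exact (lift_inst _ _).symm

/-- The substitution sending variable `0` to `v` and variable `n + 1` to `σ n`. -/
def consSubst (v : Tm C) (σ : ℕ → Tm C) : ℕ → Tm C
  | 0 => v
  | n + 1 => σ n

theorem subst_upSubst_inst (t v : Tm C) (σ : ℕ → Tm C) :
    (t.subst (upSubst σ)).inst v = t.subst (consSubst v σ) := by
  simp only [inst, subst_subst]
  congr 1
  funext n
  cases n with
  | zero => rfl
  | succ n => exact lift_inst _ _

end Tm

/-! ### Reduction with looping match failures, and its strong normalisation -/

open Relation

/-- Reduction, where moreover match failures reduce to themselves. -/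
inductive LStep {C : Type*} : Tm C → Tm C → Prop
  | appLam (t v : Tm C) : LStep (.app (.lam t) v) (t.inst v)
  | appDai (v : Tm C) : LStep (.app .dai v) .dai
  | lamApp (t : Tm C) : LStep (.lam (.app t.lift (.var 0))) t
  | lamDai : LStep (.lam .dai) .dai
  | caseCons (s : Finset C) (θ : {c // c ∈ s} → Tm C) (c : C) (h : c ∈ s) :
      LStep (.cas s θ (.con c)) (θ ⟨c, h⟩)
  | caseFail (s : Finset C) (θ : {c // c ∈ s} → Tm C) (c : C) (h : c ∉ s) :
      LStep (.cas s θ (.con c)) (.cas s θ (.con c))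
  | caseDai (s : Finset C) (θ : {c // c ∈ s} → Tm C) : LStep (.cas s θ .dai) .dai
  | caseApp (s : Finset C) (θ : {c // c ∈ s} → Tm C) (t v : Tm C) :
      LStep (.cas s θ (.app t v)) (.app (.cas s θ t) v)
  | caseLam (s : Finset C) (θ : {c // c ∈ s} → Tm C) (t : Tm C) :
      LStep (.cas s θ (.lam t)) (.lam (.cas s (fun c => (θ c).lift) t))
  | lamCongr {t t' : Tm C} : LStep t t' → LStep (.lam t) (.lam t')
  | appLeft {t t' : Tm C} (v : Tm C) : LStep t t' → LStep (.app t v) (.app t' v)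
  | appRight (t : Tm C) {v v' : Tm C} : LStep v v' → LStep (.app t v) (.app t v')
  | caseArg (s : Finset C) (θ : {c // c ∈ s} → Tm C) {t t' : Tm C} :
      LStep t t' → LStep (.cas s θ t) (.cas s θ t')
  | caseBranch (s : Finset C) (θ θ' : {c // c ∈ s} → Tm C) (t : Tm C) (c : {c // c ∈ s}) :
      LStep (θ c) (θ' c) → (∀ d, d ≠ c → θ' d = θ d) → LStep (.cas s θ t) (.cas s θ' t)

/-- One step of reduction in one component of a family of terms. -/
def BStep {C ι : Type*} (θ θ' : ι → Tm C) : Prop :=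
  ∃ c, LStep (θ c) (θ' c) ∧ ∀ d, d ≠ c → θ' d = θ d

/-- Reduction in any number of steps, with looping match failures. -/
abbrev LRed {C : Type*} : Tm C → Tm C → Prop := ReflTransGen LStep

/-- Strong normalisation for the reduction with looping match failures. -/
def SN {C : Type*} (t : Tm C) : Prop := Acc (fun a b => LStep b a) t

/-- Strong normalisation of a family of terms. -/
def SNB {C ι : Type*} (θ : ι → Tm C) : Prop := Acc (fun a b => BStep b a) θ

variable {C : Type*}

theorem LStep.branches {s : Finset C} {θ θ' : {c // c ∈ s} → Tm C} (t : Tm C) (h : BStep θ θ') :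
    LStep (.cas s θ t) (.cas s θ' t) := by
  obtain ⟨c, h1, h2⟩ := h
  exact .caseBranch s θ θ' t c h1 h2

theorem LStep.subst {t t' : Tm C} (h : LStep t t') (σ : ℕ → Tm C) :
    LStep (t.subst σ) (t'.subst σ) := by
  induction h generalizing σ with
  | appLam t v => rw [Tm.subst_inst]; exact .appLam _ _
  | appDai v => exact .appDai _
  | lamApp t =>
    simp only [Tm.subst, Tm.lift_subst_upSubst]
    exact .lamApp _
  | lamDai => exact .lamDai
  | caseCons s θ c h => exact .caseCons s (fun c => (θ c).subst σ) c h
  | caseFail s θ c h => exact .caseFail s (fun c => (θ c).subst σ) c h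
  | caseDai s θ => exact .caseDai _ _
  | caseApp s θ t v => exact .caseApp _ _ _ _
  | caseLam s θ t =>
    simp only [Tm.subst, Tm.lift_subst_upSubst]
    exact .caseLam s (fun c => (θ c).subst σ) _
  | lamCongr _ ih => exact .lamCongr (ih _)
  | appLeft v _ ih => exact .appLeft _ (ih _)
  | appRight t _ ih => exact .appRight _ (ih _)
  | caseArg s θ _ ih => exact .caseArg _ _ (ih _)
  | caseBranch s θ θ' t c _ h2 ih =>
    exact .caseBranch _ _ _ _ c (ih _) fun d hd => by rw [h2 d hd]

theorem LStep.rename {t t' : Tm C} (h : LStep t t') (ξ : ℕ → ℕ) :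
    LStep (t.rename ξ) (t'.rename ξ) := by
  rw [Tm.rename_eq_subst, Tm.rename_eq_subst]; exact h.subst _

theorem BStep.lift {ι : Type*} {θ θ' : ι → Tm C} (h : BStep θ θ') :
    BStep (fun c => (θ c).lift) fun c => (θ' c).lift := by
  obtain ⟨c, h1, h2⟩ := h
  exact ⟨c, h1.rename _, fun d hd => by simp only [h2 d hd]⟩

theorem LRed.map {f : Tm C → Tm C} (hf : ∀ t t', LStep t t' → LStep (f t) (f t')) {t t' : Tm C}
    (h : LRed t t') : LRed (f t) (f t') := by
  induction h with
  | refl => exact .refl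
  | tail _ h ih => exact ih.tail (hf _ _ h)

theorem LRed.lam {t t' : Tm C} (h : LRed t t') : LRed t.lam t'.lam :=
  h.map fun _ _ => .lamCongr

theorem LRed.app {t t' v v' : Tm C} (h : LRed t t') (h' : LRed v v') :
    LRed (t.app v) (t'.app v') :=
  (h.map (f := (Tm.app · v)) fun _ _ => .appLeft v).trans (h'.map fun _ _ => .appRight t')

theorem LRed.caseArg (s : Finset C) (θ : {c // c ∈ s} → Tm C) {t t' : Tm C} (h : LRed t t') :
    LRed (.cas s θ t) (.cas s θ t') :=
  h.map fun _ _ => .caseArg s θ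

theorem LRed.caseUpdate (s : Finset C) (θ : {c // c ∈ s} → Tm C) (c : {c // c ∈ s}) (t : Tm C)
    [DecidableEq {c // c ∈ s}] {v : Tm C} (h : LRed (θ c) v) :
    LRed (.cas s θ t) (.cas s (Function.update θ c v) t) := by
  induction h with
  | refl => rw [Function.update_eq_self]
  | tail _ h ih =>
    refine ih.tail (.caseBranch _ _ _ _ c (by simpa using h) fun d hd => ?_)
    simp [Function.update_of_ne hd]

/-- A step touches one branch only, so the finitely many branches are reduced one after the other.
-/
theorem LRed.branches (s : Finset C) {θ θ' : {c // c ∈ s} → Tm C} (t : Tm C)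
    (h : ∀ c, LRed (θ c) (θ' c)) : LRed (.cas s θ t) (.cas s θ' t) := by
  classical
  suffices H : ∀ F : Finset {c // c ∈ s},
      LRed (.cas s θ t) (.cas s (fun c => if c ∈ F then θ' c else θ c) t) by
    simpa using H Finset.univ
  intro F
  induction F using Finset.induction_on with
  | empty => simpa using ReflTransGen.refl
  | insert a F ha ih =>
    refine ih.trans ?_
    convert LRed.caseUpdate s (fun c => if c ∈ F then θ' c else θ c) a t (v := θ' a)
      (by simpa [ha] using h a) using 2
    funext c
    by_cases hc : c = a
    · subst hc; simp
    · simp [hc]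

theorem LRed.rename {t t' : Tm C} (h : LRed t t') (ξ : ℕ → ℕ) :
    LRed (t.rename ξ) (t'.rename ξ) :=
  h.map fun _ _ h => h.rename ξ

theorem LRed.subst_of_forall (t : Tm C) {σ σ' : ℕ → Tm C} (h : ∀ n, LRed (σ n) (σ' n)) :
    LRed (t.subst σ) (t.subst σ') := by
  induction t generalizing σ σ' with
  | var n => exact h n
  | con c => exact .refl
  | dai => exact .refl
  | lam t ih =>
    refine LRed.lam (ih fun n => ?_)
    cases n with
    | zero => exact .refl
    | succ n => exact (h n).rename _
  | app t v iht ihv => exact (iht h).app (ihv h)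
  | cas s θ t ihθ iht =>
    exact (LRed.branches s _ fun c => ihθ c h).trans (LRed.caseArg _ _ (iht h))

theorem LRed.inst_right (t : Tm C) {v v' : Tm C} (h : LRed v v') :
    LRed (t.inst v) (t.inst v') :=
  LRed.subst_of_forall t fun n => by
    cases n with
    | zero => exact h
    | succ n => exact .refl

theorem SN.step {t t' : Tm C} (h : SN t) (hs : LStep t t') : SN t' := Acc.inv h hs

theorem SN.red {t t' : Tm C} (h : SN t) (hs : LRed t t') : SN t' := by
  induction hs with
  | refl => exact h
  | tail _ hs ih => exact ih.step hs

theorem SN.of_map (f : Tm C → Tm C) (hf : ∀ t t', LStep t t' → LStep (f t) (f t')) {t : Tm C}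
    (h : SN (f t)) : SN t := by
  have := InvImage.accessible f h
  exact Subrelation.accessible (fun {a b} hab => hf _ _ hab) this

theorem SN.app_left {t v : Tm C} (h : SN (t.app v)) : SN t :=
  h.of_map (Tm.app · v) fun _ _ => .appLeft v

theorem SN.app_right {t v : Tm C} (h : SN (t.app v)) : SN v :=
  h.of_map (Tm.app t) fun _ _ => .appRight t

theorem SN.of_inst {t v : Tm C} (h : SN (t.inst v)) : SN t :=
  h.of_map (Tm.inst · v) fun _ _ h => h.subst _

theorem SN.branches {s : Finset C} {θ : {c // c ∈ s} → Tm C} {t : Tm C} (h : SN (.cas s θ t)) :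
    SNB θ := by
  have := InvImage.accessible (fun θ => Tm.cas s θ t) h
  exact Subrelation.accessible (fun {a b} hab => LStep.branches t hab) this

theorem SNB.apply {ι : Type*} {θ : ι → Tm C} (h : SNB θ) (c : ι) : SN (θ c) := by
  classical
  have : ∀ θ' : ι → Tm C, SNB θ' → ∀ t, θ' c = t → SN t := by
    intro θ' h
    induction h with
    | intro θ' _ ih =>
      rintro _ rfl
      refine Acc.intro _ fun t ht => ?_
      refine ih (Function.update θ' c t) ⟨c, by simpa using ht, fun d hd => ?_⟩ t (by simp)
      simp [Function.update_of_ne hd]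
  exact this θ h _ rfl

/-- A finite product of accessible elements is accessible. The induction is on the set of components
that are allowed to move. -/
theorem SNB.of_forall {ι : Type*} [Finite ι] {θ : ι → Tm C} (h : ∀ c, SN (θ c)) : SNB θ := by
  classical
  have := Fintype.ofFinite ι
  have key : ∀ (F : Finset ι) (θ : ι → Tm C), (∀ c, SN (θ c)) →
      Acc (fun a b => ∃ c ∈ F, LStep (b c) (a c) ∧ ∀ d, d ≠ c → a d = b d) θ := by
    intro F
    induction F using Finset.induction_on with
    | empty => exact fun θ _ => Acc.intro _ fun _ ⟨_, hc, _⟩ => absurd hc (Finset.notMem_empty _)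
    | insert a F ha ihF =>
      intro θ h
      generalize hx : θ a = x
      have hacc : SN x := hx ▸ h a
      induction hacc generalizing θ with
      | intro x _ ih =>
        have hF := ihF θ h
        induction hF with
        | intro θ _ ihθ =>
          refine Acc.intro _ fun θ' hθ' => ?_
          obtain ⟨c, hc, hs, hd⟩ := hθ'
          have hsn : ∀ d, SN (θ' d) := fun d => by
            by_cases hdc : d = c
            · subst hdc; exact (h d).step hs
            · rw [hd d hdc]; exact h d
          rcases Finset.mem_insert.1 hc with rfl | hc
          -- A move of the new component decreases the outer measure; any other move leaves it fixed
          -- and decreases the inner one.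
          · exact ih _ (hx ▸ hs) θ' hsn rfl
          · refine ihθ θ' ⟨c, hc, hs, hd⟩ hsn ?_
            rw [hd a fun hac => ha (hac ▸ hc), hx]
  refine Subrelation.accessible (fun {a b} hab => ?_) (key Finset.univ θ h)
  obtain ⟨c, hc⟩ := hab
  exact ⟨c, Finset.mem_univ _, hc⟩

/-! ### Weak head reduction -/

theorem Tm.app_lift_var_inst (t v : Tm C) : (t.lift.app (.var 0)).inst v = t.app v := by
  change Tm.app (t.lift.inst v) v = _
  rw [Tm.lift_inst]

theorem Tm.cas_lift_inst {s : Finset C} (θ : {c // c ∈ s} → Tm C) (t v : Tm C) :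
    (Tm.cas s (fun c => (θ c).lift) t).inst v = .cas s θ (t.inst v) := by
  change Tm.cas s (fun c => (θ c).lift.inst v) (t.inst v) = _
  simp only [Tm.lift_inst]

/-- The term is a case construct. -/
def Tm.IsCas : Tm C → Prop
  | .cas _ _ _ => True
  | _ => False

/-- Weak head reduction: a deterministic strategy in which a case construct first commutes with an
application. -/
inductive Wh : Tm C → Tm C → Prop
  | appLam (t v : Tm C) : Wh (.app (.lam t) v) (t.inst v)
  | appDai (v : Tm C) : Wh (.app .dai v) .dai
  | app {t t' : Tm C} (v : Tm C) : Wh t t' → Wh (.app t v) (.app t' v)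
  | caseCons (s : Finset C) (θ : {c // c ∈ s} → Tm C) (c : C) (h : c ∈ s) :
      Wh (.cas s θ (.con c)) (θ ⟨c, h⟩)
  | caseDai (s : Finset C) (θ : {c // c ∈ s} → Tm C) : Wh (.cas s θ .dai) .dai
  | caseApp (s : Finset C) (θ : {c // c ∈ s} → Tm C) (t v : Tm C) :
      Wh (.cas s θ (.app t v)) (.app (.cas s θ t) v)
  | caseLam (s : Finset C) (θ : {c // c ∈ s} → Tm C) (t : Tm C) :
      Wh (.cas s θ (.lam t)) (.lam (.cas s (fun c => (θ c).lift) t))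
  | cas (s : Finset C) (θ : {c // c ∈ s} → Tm C) {t t' : Tm C} :
      t.IsCas → Wh t t' → Wh (.cas s θ t) (.cas s θ t')

/-- Weak head reduction in any number of steps. -/
abbrev WhRed : Tm C → Tm C → Prop := ReflTransGen Wh

theorem Wh.lStep {t t' : Tm C} (h : Wh t t') : LStep t t' := by
  induction h with
  | appLam t v => exact .appLam t v
  | appDai v => exact .appDai v
  | app v _ ih => exact .appLeft v ih
  | caseCons s θ c h => exact .caseCons s θ c h
  | caseDai s θ => exact .caseDai s θ
  | caseApp s θ t v => exact .caseApp s θ t v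
  | caseLam s θ t => exact .caseLam s θ t
  | cas s θ _ _ ih => exact .caseArg s θ ih

theorem WhRed.lRed {t t' : Tm C} (h : WhRed t t') : LRed t t' :=
  ReflTransGen.mono (fun _ _ => Wh.lStep) _ _ h

theorem WhRed.app {t t' : Tm C} (h : WhRed t t') (v : Tm C) : WhRed (t.app v) (t'.app v) := by
  induction h with
  | refl => exact .refl
  | tail _ h ih => exact ih.tail (h.app v)

/-- The side condition `IsCas` on the congruence under case keeps it from overlapping the four root
rules for case. -/
theorem Wh.deterministic {t t₁ t₂ : Tm C} (h₁ : Wh t t₁) (h₂ : Wh t t₂) : t₁ = t₂ := by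
  induction h₁ generalizing t₂ with
  | appLam t v =>
    cases h₂ with
    | appLam => rfl
    | app _ h => cases h
  | appDai v =>
    cases h₂ with
    | appDai => rfl
    | app _ h => cases h
  | app v h ih =>
    cases h₂ with
    | appLam => cases h
    | appDai => cases h
    | app _ h' => rw [ih h']
  | caseCons s θ c h =>
    cases h₂ with
    | caseCons => rfl
    | cas _ _ h => cases h
  | caseDai s θ =>
    cases h₂ with
    | caseDai => rfl
    | cas _ _ h => cases h
  | caseApp s θ t v =>
    cases h₂ with
    | caseApp => rfl
    | cas _ _ h => cases h
  | caseLam s θ t =>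
    cases h₂ with
    | caseLam => rfl
    | cas _ _ h => cases h
  | cas s θ hc _ ih =>
    cases h₂ with
    | cas _ _ _ h' => rw [ih h']
    | _ => cases hc

/-- Reduction steps project along a weak head step. -/
theorem Wh.project {t t' t₁ : Tm C} (h : Wh t t') (hs : LStep t t₁) :
    LRed t' t₁ ∨ ∃ t₁', Wh t₁ t₁' ∧ LRed t' t₁' ∧ (t.IsCas → t₁.IsCas) := by
  induction h generalizing t₁ with
  | appLam t v =>
    cases hs with
    | appLam => exact .inl .refl
    | appLeft _ h =>
      cases h with
      -- The LamApp and AppLam contractions of this overlap give the same term.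
      | lamApp => exact .inl (by rw [Tm.app_lift_var_inst])
      | lamDai => exact .inr ⟨_, .appDai _, .refl, fun h => h⟩
      | lamCongr h => exact .inr ⟨_, .appLam _ _, .single (h.subst _), fun h => h⟩
    | appRight _ h => exact .inr ⟨_, .appLam _ _, LRed.inst_right _ (.single h), fun h => h⟩
  | appDai v =>
    cases hs with
    | appDai => exact .inl .refl
    | appLeft _ h => cases h
    | appRight _ h => exact .inr ⟨_, .appDai _, .refl, fun h => h⟩
  | app v hw ih =>
    cases hs with
    | appLam => cases hw
    | appDai => cases hw
    | appLeft _ h =>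
      rcases ih h with h | ⟨t₁', h1, h2, _⟩
      · exact .inl (h.app .refl)
      · exact .inr ⟨_, h1.app v, h2.app .refl, fun h => h⟩
    | appRight _ h => exact .inr ⟨_, hw.app _, .single (.appRight _ h), fun h => h⟩
  | caseCons s θ c h =>
    cases hs with
    | caseCons => exact .inl .refl
    | caseFail _ _ _ h' => exact absurd h h'
    | caseArg _ _ h => cases h
    | caseBranch _ _ θ' _ d h1 h2 =>
      refine .inr ⟨_, .caseCons _ _ c h, ?_, fun h => h⟩
      by_cases hd : ⟨c, h⟩ = d
      · subst hd; exact .single h1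
      · rw [h2 _ hd]
  | caseDai s θ =>
    cases hs with
    | caseDai => exact .inl .refl
    | caseArg _ _ h => cases h
    | caseBranch => exact .inr ⟨_, .caseDai _ _, .refl, fun h => h⟩
  | caseApp s θ t v =>
    cases hs with
    | caseApp => exact .inl .refl
    | caseArg _ _ h =>
      cases h with
      | appLam a =>
        -- The inner redex was contracted before the commutation; the commuted side catches up by
        -- CaseLam, then AppLam.
        exact .inl (.trans (.single (.appLeft _ (.caseLam _ _ _)))
          (.single (by rw [← Tm.cas_lift_inst]; exact .appLam _ _)))
      | appDai =>
        exact .inr ⟨_, .caseDai _ _,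
          .trans (.single (.appLeft _ (.caseDai _ _))) (.single (.appDai _)), fun h => h⟩
      | appLeft _ h =>
        exact .inr ⟨_, .caseApp _ _ _ _, .single (.appLeft _ (.caseArg _ _ h)), fun h => h⟩
      | appRight _ h => exact .inr ⟨_, .caseApp _ _ _ _, .single (.appRight _ h), fun h => h⟩
    | caseBranch _ _ θ' _ d h1 h2 =>
      exact .inr ⟨_, .caseApp _ _ _ _, .single (.appLeft _ (.branches _ ⟨d, h1, h2⟩)), fun h => h⟩
  | caseLam s θ t =>
    cases hs with
    | caseLam => exact .inl .refl
    | caseArg _ _ h =>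
      cases h with
      | lamApp a =>
        exact .inl (.trans (.single (.lamCongr (.caseApp _ _ _ _)))
          (.single (.lamApp (.cas s θ _))))
      | lamDai =>
        exact .inr ⟨_, .caseDai _ _,
          .trans (.single (.lamCongr (.caseDai _ _))) (.single .lamDai), fun h => h⟩
      | lamCongr h =>
        exact .inr ⟨_, .caseLam _ _ _, .single (.lamCongr (.caseArg _ _ h)), fun h => h⟩
    | caseBranch _ _ θ' _ d h1 h2 =>
      exact .inr ⟨_, .caseLam _ _ _,
        .single (.lamCongr (.branches _ (BStep.lift ⟨d, h1, h2⟩))), fun h => h⟩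
  | cas s θ hc hw ih =>
    cases hs with
    | caseArg _ _ h =>
      rcases ih h with h | ⟨t₁', h1, h2, h3⟩
      · exact .inl (h.caseArg _ _)
      -- The clause preserving `IsCas` is carried through the induction so that the congruence still
      -- applies here.
      · exact .inr ⟨_, .cas _ _ (h3 hc) h1, h2.caseArg _ _, fun h => h⟩
    | caseBranch _ _ θ' _ d h1 h2 =>
      exact .inr ⟨_, .cas _ _ hc hw, .single (.branches _ ⟨d, h1, h2⟩), fun h => h⟩
    | _ => cases hc

/-! ### Strong normalisation under weak head expansion -/

theorem SN.dai : SN (.dai : Tm C) := Acc.intro _ fun _ h => by cases h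

theorem SN.dai_app {v : Tm C} (h : SN v) : SN (Tm.dai.app v) := by
  induction h with
  | intro v _ ih =>
    refine Acc.intro _ fun t ht => ?_
    cases ht with
    | appDai => exact SN.dai
    | appLeft _ h => cases h
    | appRight _ h => exact ih _ h

theorem SN.cas_dai {s : Finset C} {θ : {c // c ∈ s} → Tm C} (h : SNB θ) : SN (.cas s θ .dai) := by
  induction h with
  | intro θ _ ih =>
    refine Acc.intro _ fun t ht => ?_
    cases ht with
    | caseDai => exact SN.dai
    | caseArg _ _ h => cases h
    | caseBranch _ _ θ' _ d h1 h2 => exact ih _ ⟨d, h1, h2⟩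

theorem SN.cas_con {s : Finset C} {θ : {c // c ∈ s} → Tm C} (h : SNB θ) {c : C} (hc : c ∈ s) :
    SN (.cas s θ (.con c)) := by
  induction h with
  | intro θ hθ ih =>
    refine Acc.intro _ fun t ht => ?_
    cases ht with
    | caseCons => exact SNB.apply (Acc.intro _ hθ) _
    | caseFail _ _ _ h => exact absurd hc h
    | caseArg _ _ h => cases h
    | caseBranch _ _ θ' _ d h1 h2 => exact ih _ ⟨d, h1, h2⟩

theorem SN.appLam {t v : Tm C} (h : SN (t.inst v)) (hv : SN v) : SN (t.lam.app v) := by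
  induction hv generalizing t with
  | intro v hv ihv =>
    have ht : SN t := h.of_inst
    induction ht with
    | intro t _ iht =>
      refine Acc.intro _ fun u hu => ?_
      cases hu with
      | appLam => exact h
      | appLeft _ hu =>
        cases hu with
        | lamApp => rwa [Tm.app_lift_var_inst] at h
        | lamDai => exact SN.dai_app (Acc.intro _ hv)
        | lamCongr hu => exact iht _ hu (h.step (hu.subst _))
      | appRight _ hu => exact ihv _ hu (h.red (LRed.inst_right _ (.single hu)))

/-- Internal steps are mirrored in the commuted term, except the two root contractions of the
abstraction. After LamApp the result is still reached from the commuted term, by CaseApp then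
LamApp; LamDai leaves a case construct on the Daimon. -/
theorem SN.caseLam {s : Finset C} {θ : {c // c ∈ s} → Tm C} {t : Tm C} (hθ : SNB θ)
    (h : SN (.lam (.cas s (fun c => (θ c).lift) t))) : SN (.cas s θ t.lam) := by
  generalize hx : Tm.lam (.cas s (fun c => (θ c).lift) t) = x at h
  induction h generalizing θ t with
  | intro x h ih =>
    subst hx
    refine Acc.intro _ fun u hu => ?_
    cases hu with
    | caseLam => exact Acc.intro _ h
    | caseArg _ _ hu =>
      cases hu with
      | lamApp a =>
        exact SN.step (h _ (.lamCongr (.caseApp _ _ _ _))) (.lamApp (.cas s θ _))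
      | lamDai => exact SN.cas_dai hθ
      | lamCongr hu => exact ih _ (.lamCongr (.caseArg _ _ hu)) hθ rfl
    | caseBranch _ _ θ' _ d h1 h2 =>
      have hb : BStep θ θ' := ⟨d, h1, h2⟩
      exact ih _ (.lamCongr (.branches _ hb.lift)) (Acc.inv hθ hb) rfl

theorem SN.caseApp {s : Finset C} {θ : {c // c ∈ s} → Tm C} {t v : Tm C}
    (h : SN (.app (.cas s θ t) v)) : SN (.cas s θ (t.app v)) := by
  generalize hx : Tm.app (.cas s θ t) v = x at h
  induction h generalizing θ t v with
  | intro x h ih =>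
    subst hx
    refine Acc.intro _ fun u hu => ?_
    cases hu with
    | caseApp => exact Acc.intro _ h
    | caseArg _ _ hu =>
      cases hu with
      | appLam a =>
        refine SN.step (h _ (.appLeft _ (.caseLam _ _ _))) ?_
        rw [← Tm.cas_lift_inst]
        exact .appLam _ _
      | appDai => exact SN.cas_dai (SN.branches (SN.app_left (Acc.intro _ h)))
      | appLeft _ hu => exact ih _ (.appLeft _ (.caseArg _ _ hu)) rfl
      | appRight _ hu => exact ih _ (.appRight _ hu) rfl
    | caseBranch _ _ θ' _ d h1 h2 => exact ih _ (.appLeft _ (.branches _ ⟨d, h1, h2⟩)) rfl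

/-- As `t` has a weak head step, it is neither an abstraction nor the Daimon, so every step is
inside `t` or `v`. Steps inside `t` project onto `t'` by `Wh.project`. -/
theorem SN.app_of_wh {t t' v : Tm C} (hw : Wh t t') (ht : SN t) (hv : SN v)
    (h : SN (t'.app v)) : SN (t.app v) := by
  induction ht generalizing t' v with
  | intro t _ iht =>
    induction hv with
    | intro v hv ihv =>
      refine Acc.intro _ fun u hu => ?_
      cases hu with
      | appLam => cases hw
      | appDai => cases hw
      | appLeft _ hu =>
        rcases hw.project hu with h' | ⟨t₁', h1, h2, _⟩
        · exact h.red (h'.app .refl)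
        · exact iht _ hu h1 (Acc.intro _ hv) (h.red (h2.app .refl))
      | appRight _ hu => exact ihv _ hu (h.step (.appRight _ hu))

theorem SN.app_of_whRed {t t' v : Tm C} (hw : WhRed t t') (ht : SN t) (hv : SN v)
    (h : SN (t'.app v)) : SN (t.app v) := by
  induction hw using ReflTransGen.head_induction_on with
  | refl => exact h
  | head hw _ ih => exact SN.app_of_wh hw ht hv (ih (ht.step hw.lStep))

theorem SN.cas_of_wh_of_isCas {s : Finset C} {θ : {c // c ∈ s} → Tm C} {t t' : Tm C}
    (hw : Wh t t') (hc : t.IsCas) (ht : SN t) (hθ : SNB θ) (h : SN (.cas s θ t')) :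
    SN (.cas s θ t) := by
  induction ht generalizing t' θ with
  | intro t _ iht =>
    induction hθ with
    | intro θ hθ ihθ =>
      refine Acc.intro _ fun u hu => ?_
      cases hu with
      | caseArg _ _ hu =>
        rcases hw.project hu with h' | ⟨t₁', h1, h2, h3⟩
        · exact h.red (h'.caseArg _ _)
        · exact iht _ hu h1 (h3 hc) (Acc.intro _ hθ) (h.red (h2.caseArg _ _))
      | caseBranch _ _ θ' _ d h1 h2 =>
        have hb : BStep θ θ' := ⟨d, h1, h2⟩
        exact ihθ _ hb (h.step (.branches _ hb))
      | _ => cases hc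

/-- The case constructs over the two sides of a weak head step have a common weak head reduct. -/
theorem Wh.cas_join {t t' : Tm C} (hw : Wh t t') (s : Finset C) (θ : {c // c ∈ s} → Tm C) :
    ∃ r, WhRed (.cas s θ t) r ∧ WhRed (.cas s θ t') r := by
  induction hw with
  | appLam t v =>
    -- The case construct crosses the application, then the abstraction, and only then is the redex
    -- contracted.
    refine ⟨_, .head (.caseApp _ _ _ _) (.head (.app _ (.caseLam _ _ _)) (.single ?_)), .refl⟩
    rw [← Tm.cas_lift_inst]
    exact .appLam _ _
  | appDai v =>
    exact ⟨_, .head (.caseApp _ _ _ _) (.head (.app _ (.caseDai _ _)) (.single (.appDai _))),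
      .single (.caseDai _ _)⟩
  | app v _ ih =>
    obtain ⟨r, h1, h2⟩ := ih
    exact ⟨_, .head (.caseApp _ _ _ _) (WhRed.app h1 v), .head (.caseApp _ _ _ _) (WhRed.app h2 v)⟩
  | caseCons s' θ' c h => exact ⟨_, .single (.cas _ _ trivial (.caseCons _ _ _ h)), .refl⟩
  | caseDai s' θ' => exact ⟨_, .single (.cas _ _ trivial (.caseDai _ _)), .refl⟩
  | caseApp s' θ' t v => exact ⟨_, .single (.cas _ _ trivial (.caseApp _ _ _ _)), .refl⟩
  | caseLam s' θ' t => exact ⟨_, .single (.cas _ _ trivial (.caseLam _ _ _)), .refl⟩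
  | cas s' θ' hc hw _ => exact ⟨_, .single (.cas _ _ trivial (.cas _ _ hc hw)), .refl⟩

/-- If `t` is an application, `SN.caseApp` reduces the claim to the commuted term, whose function
part is handled by recursion and `Wh.cas_join`. If `t` is a case construct, no rule applies at the
root and steps project directly. -/
theorem SN.cas_of_wh {s : Finset C} {θ : {c // c ∈ s} → Tm C} {t t' : Tm C}
    (hw : Wh t t') (ht : SN t) (hθ : SNB θ) (h : SN (.cas s θ t')) : SN (.cas s θ t) := by
  induction hw with
  | appLam t v =>
    have h' : SN (.app (.lam (.cas s (fun c => (θ c).lift) t)) v) := by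
      refine SN.appLam ?_ ht.app_right
      rwa [Tm.cas_lift_inst]
    exact SN.caseApp (SN.app_of_wh (.caseLam _ _ _) (SN.caseLam hθ h'.app_left) ht.app_right h')
  | appDai v =>
    exact SN.caseApp (SN.app_of_wh (.caseDai _ _) (SN.cas_dai hθ) ht.app_right
      (SN.dai_app ht.app_right))
  | app v hw ih =>
    have h' := h.step (.caseApp _ _ _ _)
    obtain ⟨r, h1, h2⟩ := hw.cas_join s θ
    exact SN.caseApp (SN.app_of_whRed h1 (ih ht.app_left h'.app_left) ht.app_right
      (h'.red (LRed.app h2.lRed .refl)))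
  | caseCons s' θ' c hc =>
    exact SN.cas_of_wh_of_isCas (.caseCons s' θ' c hc) trivial ht hθ h
  | caseDai s' θ' => exact SN.cas_of_wh_of_isCas (.caseDai s' θ') trivial ht hθ h
  | caseApp s' θ' t v => exact SN.cas_of_wh_of_isCas (.caseApp s' θ' t v) trivial ht hθ h
  | caseLam s' θ' t => exact SN.cas_of_wh_of_isCas (.caseLam s' θ' t) trivial ht hθ h
  | cas s' θ' hc hw _ => exact SN.cas_of_wh_of_isCas (.cas s' θ' hc hw) trivial ht hθ h

/-! ### Variable-headed and constructor-headed terms -/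

/-- The terms headed by a variable. -/
inductive Neutral : Tm C → Prop
  | var (n : ℕ) : Neutral (.var n)
  | app {t : Tm C} (v : Tm C) : Neutral t → Neutral (.app t v)
  | cas (s : Finset C) (θ : {c // c ∈ s} → Tm C) {t : Tm C} : Neutral t → Neutral (.cas s θ t)

/-- The terms made of a constructor applied to arguments. -/
inductive ConHead : Tm C → Prop
  | con (c : C) : ConHead (.con c)
  | app {t : Tm C} (v : Tm C) : ConHead t → ConHead (.app t v)

theorem Neutral.lStep {t t' : Tm C} (h : Neutral t) (hs : LStep t t') : Neutral t' := by
  induction h generalizing t' with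
  | var n => cases hs
  | app v h ih =>
    cases hs with
    | appLam => cases h
    | appDai => cases h
    | appLeft _ hs => exact .app _ (ih hs)
    | appRight _ hs => exact .app _ h
  | cas s θ h ih =>
    cases hs with
    | caseCons => cases h
    | caseFail => cases h
    | caseDai => cases h
    | caseApp => cases h with | app _ h => exact .app _ (.cas _ _ h)
    | caseLam => cases h
    | caseArg _ _ hs => exact .cas _ _ (ih hs)
    | caseBranch => exact .cas _ _ h

theorem ConHead.lStep {t t' : Tm C} (h : ConHead t) (hs : LStep t t') : ConHead t' := by
  induction h generalizing t' with
  | con c => cases hs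
  | app v h ih =>
    cases hs with
    | appLam => cases h
    | appDai => cases h
    | appLeft _ hs => exact .app _ (ih hs)
    | appRight _ hs => exact .app _ h

theorem ConHead.not_wh {t t' : Tm C} (h : ConHead t) : ¬ Wh t t' := by
  induction h generalizing t' with
  | con c => intro hs; cases hs
  | app v h ih =>
    intro hs
    cases hs with
    | appLam => cases h
    | appDai => cases h
    | app _ hs => exact ih hs

/-- The invariant `P` ensures that no reduct of the application becomes a redex at its root. -/
theorem SN.app_of_stable (P : Tm C → Prop) (hP : ∀ t t', P t → LStep t t' → P t')
    (hlam : ∀ t, ¬ P (.lam t)) (hdai : ¬ P .dai) {t v : Tm C} (h : P t) (ht : SN t) (hv : SN v) :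
    SN (t.app v) := by
  induction ht generalizing v with
  | intro t _ iht =>
    induction hv with
    | intro v hv ihv =>
      refine Acc.intro _ fun u hu => ?_
      cases hu with
      | appLam => exact absurd h (hlam _)
      | appDai => exact absurd h hdai
      | appLeft _ hu => exact iht _ hu (hP _ _ h hu) (Acc.intro _ hv)
      | appRight _ hu => exact ihv _ hu

theorem Neutral.sn_app {t v : Tm C} (h : Neutral t) (ht : SN t) (hv : SN v) : SN (t.app v) :=
  SN.app_of_stable Neutral (fun _ _ => Neutral.lStep) (fun _ => nofun) nofun h ht hv

theorem ConHead.sn_app {t v : Tm C} (h : ConHead t) (ht : SN t) (hv : SN v) : SN (t.app v) :=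
  SN.app_of_stable ConHead (fun _ _ => ConHead.lStep) (fun _ => nofun) nofun h ht hv

/-- The number of applications and case constructs above the head of a term. -/
def Tm.spine : Tm C → ℕ
  | .app t _ => t.spine + 1
  | .cas _ _ t => t.spine + 1
  | _ => 0

theorem Neutral.spine_lStep {t t' : Tm C} (h : Neutral t) (hs : LStep t t') :
    t'.spine = t.spine := by
  induction h generalizing t' with
  | var n => cases hs
  | app v h ih =>
    cases hs with
    | appLam => cases h
    | appDai => cases h
    | appLeft _ hs => simp [Tm.spine, ih hs]
    | appRight _ hs => rfl
  | cas s θ h ih =>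
    cases hs with
    | caseCons => cases h
    | caseFail => cases h
    | caseDai => cases h
    | caseApp => rfl
    | caseLam => cases h
    | caseArg _ _ hs => simp [Tm.spine, ih hs]
    | caseBranch => rfl

theorem Neutral.sn_cas {s : Finset C} {θ : {c // c ∈ s} → Tm C} {t : Tm C} (h : Neutral t)
    (ht : SN t) (hθ : SNB θ) : SN (.cas s θ t) := by
  generalize hk : t.spine = k
  induction k using Nat.strong_induction_on generalizing t θ with
  | _ k ihk =>
    induction ht generalizing θ with
    | intro t ht iht =>
      induction hθ with
      | intro θ hθ ihθ =>
        refine Acc.intro _ fun u hu => ?_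
        cases hu with
        | caseCons => cases h
        | caseFail => cases h
        | caseDai => cases h
        | caseLam => cases h
        | caseApp _ _ a v =>
          cases h with
          | app _ h =>
            have ht' : SN (a.app v) := Acc.intro _ ht
            -- Commutation puts the case construct on a term with a shorter spine. The other steps
            -- preserve the spine length (`Neutral.spine_lStep`), so it can be the outermost
            -- measure.
            exact Neutral.sn_app (.cas _ _ h)
              (ihk a.spine (hk ▸ Nat.lt_succ_self _) h ht'.app_left (Acc.intro _ hθ) rfl)
              ht'.app_right
        | caseArg _ _ hu =>
          exact iht _ hu (h.lStep hu) (Acc.intro _ hθ) ((h.spine_lStep hu).trans hk)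
        | caseBranch _ _ θ' _ d h1 h2 => exact ihθ _ ⟨d, h1, h2⟩

/-- The case construct crosses the arguments from the last to the first, and then selects its
branch. -/
theorem SN.cas_foldl_con {s : Finset C} {θ : {c // c ∈ s} → Tm C} (hθ : SNB θ) (c : {c // c ∈ s})
    (vs : List (Tm C)) (ht : SN (vs.foldl Tm.app (.con c.1)))
    (h : SN (vs.foldl Tm.app (θ c))) :
    SN (.cas s θ (vs.foldl Tm.app (.con c.1))) ∧
      WhRed (.cas s θ (vs.foldl Tm.app (.con c.1))) (vs.foldl Tm.app (θ c)) := by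
  induction vs using List.reverseRecOn with
  | nil => exact ⟨SN.cas_con hθ c.2, .single (.caseCons _ _ _ c.2)⟩
  | append_singleton vs v ih =>
    simp only [List.foldl_append, List.foldl_cons, List.foldl_nil] at ht h ⊢
    obtain ⟨h1, h2⟩ := ih ht.app_left h.app_left
    exact ⟨SN.caseApp (SN.app_of_whRed h2 h1 ht.app_right h),
      .head (.caseApp _ _ _ _) (WhRed.app h2 v)⟩

theorem Wh.whRed_cases {t t' v : Tm C} (h : Wh t t') (hv : WhRed t v) : t = v ∨ WhRed t' v := by
  rcases ReflTransGen.cases_head hv with h1 | ⟨u, h1, h2⟩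
  · exact .inl h1
  · exact .inr (h.deterministic h1 ▸ h2)

theorem ConHead.eq_of_whRed {d v : Tm C} (hd : ConHead d) (h : WhRed d v) : d = v := by
  rcases ReflTransGen.cases_head h with h1 | ⟨u, h1, _⟩
  · exact h1
  · exact absurd h1 hd.not_wh

/-- Constructor-headed terms are weak head normal and the strategy is deterministic. -/
theorem ConHead.eq_of_whRed_of_whRed {t d d' : Tm C} (hd : ConHead d) (hd' : ConHead d')
    (h : WhRed t d) (h' : WhRed t d') : d = d' := by
  induction h using ReflTransGen.head_induction_on with
  | refl => exact hd.eq_of_whRed h'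
  | head hw _ ih =>
    rcases hw.whRed_cases h' with rfl | h'
    · exact absurd hw hd'.not_wh
    · exact ih h'

/-! ### Saturated sets -/

/-- The strongly normalising terms with a weak head reduct which is the Daimon or is headed by a
variable. -/
def bot : Set (Tm C) := {t | SN t ∧ ∃ v, WhRed t v ∧ (v = .dai ∨ Neutral v)}

theorem SN.var (n : ℕ) : SN (.var n : Tm C) := Acc.intro _ fun _ h => by cases h

theorem SN.con (c : C) : SN (.con c) := Acc.intro _ fun _ h => by cases h

theorem dai_mem_bot : (.dai : Tm C) ∈ bot := ⟨SN.dai, _, .refl, .inl rfl⟩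

theorem var_mem_bot (n : ℕ) : (.var n : Tm C) ∈ bot :=
  ⟨SN.var n, _, .refl, .inr (.var n)⟩

theorem ConHead.not_neutral {d : Tm C} (hd : ConHead d) : ¬ Neutral d := by
  induction hd with
  | con c => exact nofun
  | app v _ ih =>
    intro h
    cases h with
    | app _ h => exact ih h

theorem ConHead.notMem_bot {d : Tm C} (hd : ConHead d) : d ∉ bot := by
  rintro ⟨_, v, h, hv⟩
  obtain rfl := hd.eq_of_whRed h
  rcases hv with rfl | hv
  · cases hd
  · exact hd.not_neutral hv

/-- Saturated sets of terms: the interpretations of types. -/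
structure Saturated (A : Set (Tm C)) : Prop where
  sn : ∀ t ∈ A, SN t
  bot_subset : bot ⊆ A
  red : ∀ t t', t ∈ A → Wh t t' → t' ∈ A
  exp : ∀ t t', SN t → Wh t t' → t' ∈ A → t ∈ A

theorem Saturated.whRed {A : Set (Tm C)} (hA : Saturated A) {t t' : Tm C} (h : WhRed t t')
    (ht : t ∈ A) : t' ∈ A := by
  induction h with
  | refl => exact ht
  | tail _ h ih => exact hA.red _ _ ih h

theorem Saturated.of_whRed {A : Set (Tm C)} (hA : Saturated A) {t t' : Tm C} (h : WhRed t t')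
    (ht : SN t) (ht' : t' ∈ A) : t ∈ A := by
  induction h using ReflTransGen.head_induction_on with
  | refl => exact ht'
  | head h _ ih => exact hA.exp _ _ ht h (ih (ht.step h.lStep))

/-- Replaces the missing congruence under case: membership passes forward to the common reduct of
`Wh.cas_join`, then backward by expansion. -/
theorem Saturated.cas_of_whRed {A : Set (Tm C)} (hA : Saturated A) {s : Finset C}
    {θ : {c // c ∈ s} → Tm C} (hθ : SNB θ) {t t' : Tm C} (h : WhRed t t') (ht : SN t)
    (ht' : .cas s θ t' ∈ A) : .cas s θ t ∈ A := by
  induction h using ReflTransGen.head_induction_on with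
  | refl => exact ht'
  | head h _ ih =>
    have := ih (ht.step h.lStep)
    obtain ⟨r, h1, h2⟩ := h.cas_join s θ
    exact hA.of_whRed h1 (SN.cas_of_wh h ht hθ (hA.sn _ this)) (hA.whRed h2 this)

theorem saturated_bot : Saturated (bot : Set (Tm C)) where
  sn _ h := h.1
  bot_subset _ h := h
  red t t' h hw := by
    obtain ⟨h, v, h1, h2⟩ := h
    refine ⟨h.step hw.lStep, ?_⟩
    rcases hw.whRed_cases h1 with rfl | h1
    · refine ⟨t', .refl, ?_⟩
      rcases h2 with rfl | h2
      · cases hw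
      · exact .inr (h2.lStep hw.lStep)
    · exact ⟨v, h1, h2⟩
  exp t t' h hw h' := by
    obtain ⟨_, v, h1, h2⟩ := h'
    exact ⟨h, v, .head hw h1, h2⟩

theorem app_mem_bot {t v : Tm C} (ht : t ∈ bot) (hv : SN v) : t.app v ∈ bot := by
  obtain ⟨h, w, h1, rfl | h2⟩ := ht
  · exact ⟨SN.app_of_whRed h1 h hv (SN.dai_app hv), _, (WhRed.app h1 v).tail (.appDai v), .inl rfl⟩
  · exact ⟨SN.app_of_whRed h1 h hv (h2.sn_app (h.red h1.lRed) hv), _, WhRed.app h1 v,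
      .inr (.app _ h2)⟩

theorem cas_mem_bot {s : Finset C} {θ : {c // c ∈ s} → Tm C} (hθ : SNB θ) {t : Tm C}
    (ht : t ∈ bot) : .cas s θ t ∈ bot := by
  obtain ⟨h, w, h1, h2⟩ := ht
  refine saturated_bot.cas_of_whRed hθ h1 h ?_
  rcases h2 with rfl | h2
  · exact ⟨SN.cas_dai hθ, _, .single (.caseDai _ _), .inl rfl⟩
  · exact ⟨h2.sn_cas (h.red h1.lRed) hθ, _, .refl, .inr (.cas _ _ h2)⟩

/-! ### Candidates and the interpretation of types -/

/-- The sets over which type variables of a given kind range. -/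
def IsCand (k : Kind) (A : Set (Tm C)) : Prop :=
  Saturated A ∧ (k = .data → ∀ t ∈ A, t ∉ bot → ∃ d, ConHead d ∧ WhRed t d)

theorem isCand_bot (k : Kind) : IsCand k (bot : Set (Tm C)) :=
  ⟨saturated_bot, fun _ _ h h' => absurd h h'⟩

/-- Valuations of the type variables. -/
abbrev Env (C : Type*) := Kind → ℕ → Set (Tm C)

/-- All the variables are interpreted in the right class of sets. -/
def Env.Valid (ρ : Env C) : Prop := ∀ k n, IsCand k (ρ k n)

/-- Extension of a valuation by a new variable of kind `k`. -/
def Env.push (k : Kind) (A : Set (Tm C)) (ρ : Env C) : Env C := fun j n =>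
  if j = k then
    match n with
    | 0 => A
    | m + 1 => ρ j m
  else ρ j n

theorem Env.Valid.push {ρ : Env C} (hρ : ρ.Valid) {k : Kind} {A : Set (Tm C)} (hA : IsCand k A) :
    (ρ.push k A).Valid := by
  intro j n
  unfold Env.push
  split_ifs with h
  · subst h
    cases n with
    | zero => exact hA
    | succ n => exact hρ _ _
  · exact hρ _ _

/-- The interpretation of types as sets of terms. -/
def Ty.interp : Ty C → Env C → Set (Tm C)
  | var k n, ρ => ρ k n
  | con c, _ => bot ∪ {t | SN t ∧ WhRed t (.con c)}
  | app D T, ρ =>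
    bot ∪ {t | SN t ∧ ∃ d v, WhRed t (.app d v) ∧ ConHead d ∧ d ∈ D.interp ρ ∧ v ∈ T.interp ρ}
  | arrow T U, ρ => {t | ∀ v ∈ T.interp ρ, .app t v ∈ U.interp ρ}
  | union T U, ρ => T.interp ρ ∪ U.interp ρ
  | inter T U, ρ => T.interp ρ ∩ U.interp ρ
  | all k T, ρ => {t | ∀ A, IsCand k A → t ∈ T.interp (ρ.push k A)}
  | ex k T, ρ => {t | ∃ A, IsCand k A ∧ t ∈ T.interp (ρ.push k A)}

theorem saturated_bot_union {P : Tm C → Prop} (hP : ∀ t t', P t → Wh t t' → P t')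
    (hP' : ∀ t t', Wh t t' → P t' → P t) : Saturated (bot ∪ {t | SN t ∧ P t}) where
  sn _ h := h.elim (fun h => h.1) fun h => h.1
  bot_subset _ h := .inl h
  red _ _ h hw := h.elim (fun h => .inl (saturated_bot.red _ _ h hw))
    fun h => .inr ⟨h.1.step hw.lStep, hP _ _ h.2 hw⟩
  exp _ _ h hw h' := h'.elim (fun h' => .inl (saturated_bot.exp _ _ h hw h'))
    fun h' => .inr ⟨h, hP' _ _ hw h'.2⟩

theorem Saturated.arrow {A B : Set (Tm C)} (hA : Saturated A) (hB : Saturated B) :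
    Saturated {t : Tm C | ∀ v ∈ A, .app t v ∈ B} where
  sn _ h := (hB.sn _ (h _ (hA.bot_subset dai_mem_bot))).app_left
  bot_subset _ h v hv := hB.bot_subset (app_mem_bot h (hA.sn v hv))
  red _ _ h hw v hv := hB.red _ _ (h v hv) (.app v hw)
  exp _ _ h hw h' v hv :=
    hB.exp _ _ (SN.app_of_wh hw h (hA.sn v hv) (hB.sn _ (h' v hv))) (.app v hw) (h' v hv)

/-- Each closure condition follows one term at a time, so unions of saturated sets need no
completion. For quantifiers, `bot` witnesses that there is at least one candidate. -/
theorem Ty.saturated_interp (T : Ty C) {ρ : Env C} (hρ : ρ.Valid) : Saturated (T.interp ρ) := by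
  induction T generalizing ρ with
  | var k n => exact (hρ k n).1
  | con c =>
    refine saturated_bot_union (fun t t' h hw => ?_) fun t t' hw h => .head hw h
    rcases hw.whRed_cases h with rfl | h
    · cases hw
    · exact h
  | app D T ihD ihT =>
    refine saturated_bot_union (fun t t' h hw => ?_) fun t t' hw h => ?_
    · obtain ⟨d, v, h, hd, h'⟩ := h
      rcases hw.whRed_cases h with rfl | h
      · exact absurd hw (ConHead.app v hd).not_wh
      · exact ⟨d, v, h, hd, h'⟩
    · obtain ⟨d, v, h, h'⟩ := h
      exact ⟨d, v, .head hw h, h'⟩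
  | arrow T U ihT ihU => exact (ihT hρ).arrow (ihU hρ)
  | union T U ihT ihU =>
    exact
      { sn t h := h.elim ((ihT hρ).sn t) ((ihU hρ).sn t)
        bot_subset t h := .inl ((ihT hρ).bot_subset h)
        red t t' h hw := h.imp (fun h => (ihT hρ).red t t' h hw) fun h => (ihU hρ).red t t' h hw
        exp t t' ht hw h := h.imp ((ihT hρ).exp t t' ht hw) ((ihU hρ).exp t t' ht hw) }
  | inter T U ihT ihU =>
    exact
      { sn t h := (ihT hρ).sn t h.1
        bot_subset t h := ⟨(ihT hρ).bot_subset h, (ihU hρ).bot_subset h⟩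
        red t t' h hw := h.imp (fun h => (ihT hρ).red t t' h hw) fun h => (ihU hρ).red t t' h hw
        exp t t' ht hw h := h.imp ((ihT hρ).exp t t' ht hw) ((ihU hρ).exp t t' ht hw) }
  | all k T ih =>
    exact
      { sn t h := (ih (hρ.push (isCand_bot k))).sn t (h _ (isCand_bot k))
        bot_subset t h A hA := (ih (hρ.push hA)).bot_subset h
        red t t' h hw A hA := (ih (hρ.push hA)).red t t' (h A hA) hw
        exp t t' ht hw h A hA := (ih (hρ.push hA)).exp t t' ht hw (h A hA) }
  | ex k T ih =>
    exact
      { sn := fun t ⟨A, hA, h⟩ => (ih (hρ.push hA)).sn t h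
        bot_subset := fun t h => ⟨bot, isCand_bot k, (ih (hρ.push (isCand_bot k))).bot_subset h⟩
        red := fun t t' ⟨A, hA, h⟩ hw => ⟨A, hA, (ih (hρ.push hA)).red t t' h hw⟩
        exp := fun t t' ht hw ⟨A, hA, h⟩ => ⟨A, hA, (ih (hρ.push hA)).exp t t' ht hw h⟩ }

/-- Justifies instantiating a type variable by a type of its kind: data types only contain `bot` and
terms with a constructor-headed value. -/
theorem HasKind.isCand {k : Kind} {T : Ty C} (h : HasKind k T) {ρ : Env C} (hρ : ρ.Valid) :
    IsCand k (T.interp ρ) := by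
  refine ⟨T.saturated_interp hρ, ?_⟩
  induction h generalizing ρ with
  | var k n => exact (hρ k n).2
  | ofData => exact nofun
  | con c => exact fun _ t h h' => ⟨_, .con c, (h.resolve_left h').2⟩
  | app =>
    intro _ t h h'
    obtain ⟨_, d, v, h, hd, _⟩ := h.resolve_left h'
    exact ⟨_, .app v hd, h⟩
  | arrow => exact nofun
  | union _ _ ihT ihU => exact fun hk t h h' => h.elim (ihT hρ hk t · h') (ihU hρ hk t · h')
  | inter _ _ ihT _ => exact fun hk t h h' => ihT hρ hk t h.1 h'
  | all j _ ih => exact fun hk t h h' => ih (hρ.push (isCand_bot j)) hk t (h _ (isCand_bot j)) h'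
  | ex j _ ih => exact fun hk t ⟨A, hA, h⟩ h' => ih (hρ.push hA) hk t h h'

theorem Env.push_upRen (k : Kind) (A : Set (Tm C)) (ρ : Env C) (ξ : Kind → ℕ → ℕ) :
    (fun j n => ρ.push k A j (Ty.upRen k ξ j n)) = Env.push k A fun j n => ρ j (ξ j n) := by
  funext j n
  by_cases h : j = k
  · subst h; cases n <;> simp [Env.push, Ty.upRen]
  · simp [Env.push, Ty.upRen, h]

theorem Ty.interp_rename (T : Ty C) (ξ : Kind → ℕ → ℕ) (ρ : Env C) :
    (T.rename ξ).interp ρ = T.interp fun k n => ρ k (ξ k n) := by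
  induction T generalizing ξ ρ with
  | var k n => rfl
  | con c => rfl
  | app D T ihD ihT => simp [rename, interp, ihD, ihT]
  | arrow T U ihT ihU => simp [rename, interp, ihT, ihU]
  | union T U ihT ihU => simp [rename, interp, ihT, ihU]
  | inter T U ihT ihU => simp [rename, interp, ihT, ihU]
  | all k T ih => simp [rename, interp, ih, Env.push_upRen]
  | ex k T ih => simp [rename, interp, ih, Env.push_upRen]

@[simp] theorem Ty.interp_lift_push (T : Ty C) (k : Kind) (A : Set (Tm C)) (ρ : Env C) :
    (T.lift k).interp (ρ.push k A) = T.interp ρ := by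
  rw [lift, interp_rename]
  congr 1
  funext j n
  by_cases h : j = k
  · subst h; simp [Env.push]
  · simp [Env.push, h]

theorem Ty.interp_upSubst (k : Kind) (A : Set (Tm C)) (σ : Kind → ℕ → Ty C) (ρ : Env C) :
    (fun j n => (upSubst k σ j n).interp (ρ.push k A)) =
      Env.push k A fun j n => (σ j n).interp ρ := by
  funext j n
  by_cases h : j = k
  · subst h
    cases n
    · simp [Env.push, upSubst, interp]
    · simp only [upSubst, if_true, interp_lift_push]; simp [Env.push]
  · simp only [upSubst, h, if_false, interp_lift_push]; simp [Env.push, h]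

theorem Ty.interp_subst (T : Ty C) (σ : Kind → ℕ → Ty C) (ρ : Env C) :
    (T.subst σ).interp ρ = T.interp fun k n => (σ k n).interp ρ := by
  induction T generalizing σ ρ with
  | var k n => rfl
  | con c => rfl
  | app D T ihD ihT => simp [subst, interp, ihD, ihT]
  | arrow T U ihT ihU => simp [subst, interp, ihT, ihU]
  | union T U ihT ihU => simp [subst, interp, ihT, ihU]
  | inter T U ihT ihU => simp [subst, interp, ihT, ihU]
  | all k T ih => simp [subst, interp, ih, Ty.interp_upSubst]
  | ex k T ih => simp [subst, interp, ih, Ty.interp_upSubst]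

theorem Ty.interp_inst (k : Kind) (T U : Ty C) (ρ : Env C) :
    (T.inst k U).interp ρ = T.interp (ρ.push k (U.interp ρ)) := by
  rw [inst, interp_subst]
  congr 1
  funext j n
  by_cases h : j = k
  · subst h; cases n <;> simp [Env.push, single, interp]
  · simp [Env.push, single, interp, h]

theorem Ty.mem_interp_bigInter {n : ℕ} {T : Fin (n + 1) → Ty C} {ρ : Env C} {t : Tm C} :
    t ∈ (bigInter n T).interp ρ ↔ ∀ i, t ∈ (T i).interp ρ := by
  induction n with
  | zero => simp [bigInter, Fin.forall_fin_one]
  | succ n ih => rw [Fin.forall_fin_succ, ← ih]; rfl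

theorem Ty.mem_interp_bigUnion {n : ℕ} {T : Fin (n + 1) → Ty C} {ρ : Env C} {t : Tm C} :
    t ∈ (bigUnion n T).interp ρ ↔ ∃ i, t ∈ (T i).interp ρ := by
  induction n with
  | zero => simp [bigUnion, Fin.exists_fin_one]
  | succ n ih => rw [Fin.exists_fin_succ, ← ih]; rfl

theorem ConHead.foldl_con (c : C) (vs : List (Tm C)) : ConHead (vs.foldl Tm.app (.con c)) := by
  induction vs using List.reverseRecOn with
  | nil => exact .con c
  | append_singleton vs v ih => simpa using ConHead.app v ih

theorem foldl_app_con_inj {c c' : C} {vs vs' : List (Tm C)}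
    (h : vs.foldl Tm.app (.con c) = vs'.foldl Tm.app (.con c')) : c = c' := by
  induction vs using List.reverseRecOn generalizing vs' with
  | nil =>
    cases vs' using List.reverseRecOn with
    | nil => simpa using h
    | append_singleton vs' v' => simp at h
  | append_singleton vs v ih =>
    cases vs' using List.reverseRecOn with
    | nil => simp at h
    | append_singleton vs' v' => exact ih (by simp at h; exact h.1)

theorem Ty.mem_interp_conApps {c : C} {Us : List (Ty C)} {ρ : Env C} {t : Tm C}
    (h : t ∈ (conApps c Us).interp ρ) :
    t ∈ bot ∨ ∃ vs, WhRed t (vs.foldl Tm.app (.con c)) ∧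
      List.Forall₂ (fun v U => v ∈ U.interp ρ) vs Us := by
  induction Us using List.reverseRecOn generalizing t with
  | nil => exact h.imp_right fun h => ⟨[], h.2, .nil⟩
  | append_singleton Us U ih =>
    simp only [conApps, List.foldl_append, List.foldl_cons, List.foldl_nil] at h
    refine h.imp_right ?_
    rintro ⟨_, d, v, h1, hd, h2, h3⟩
    -- The head `d` is already a weak head normal value outside `bot`, so it must equal the term
    -- supplied by induction.
    obtain ⟨vs, h4, h5⟩ := (ih h2).resolve_left hd.notMem_bot
    obtain rfl := hd.eq_of_whRed h4
    exact ⟨vs ++ [v], by simpa using h1, List.rel_append h5 (.cons h3 .nil)⟩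

theorem Ty.foldl_app_mem_interp {Us : List (Ty C)} {T : Ty C} {ρ : Env C} {vs : List (Tm C)}
    (hv : List.Forall₂ (fun v U => v ∈ U.interp ρ) vs Us) {t : Tm C}
    (h : t ∈ (arrows Us T).interp ρ) : vs.foldl Tm.app t ∈ T.interp ρ := by
  induction hv generalizing t with
  | nil => exact h
  | cons hv _ ih => exact ih (h _ hv)

/-! ### Soundness of sub-typing -/

theorem Ty.app_interp_mono {D D' T T' : Ty C} {ρ ρ' : Env C} (hD : D.interp ρ ⊆ D'.interp ρ')
    (hT : T.interp ρ ⊆ T'.interp ρ') : (app D T).interp ρ ⊆ (app D' T').interp ρ' :=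
  fun _ h => h.imp_right fun ⟨h, d, v, h1, h2, h3, h4⟩ => ⟨h, d, v, h1, h2, hD h3, hT h4⟩

/-- A term which is in every `D i` applied to `T i` has the same witness for all `i`. -/
theorem mem_bot_or_of_forall_mem_app {ι : Type*} [Nonempty ι] {D T : ι → Set (Tm C)} {t : Tm C}
    (h : ∀ i, t ∈ bot ∪
      {t | SN t ∧ ∃ d v, WhRed t (.app d v) ∧ ConHead d ∧ d ∈ D i ∧ v ∈ T i}) :
    t ∈ bot ∪ {t | SN t ∧ ∃ d v, WhRed t (.app d v) ∧ ConHead d ∧ (∀ i, d ∈ D i) ∧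
      ∀ i, v ∈ T i} := by
  by_cases hb : t ∈ bot
  · exact .inl hb
  obtain ⟨i₀⟩ := ‹Nonempty ι›
  obtain ⟨ht, d, v, h1, hd, _, _⟩ := (h i₀).resolve_left hb
  have key : ∀ i, d ∈ D i ∧ v ∈ T i := fun i => by
    obtain ⟨_, d', v', h1', hd', h2, h3⟩ := (h i).resolve_left hb
    have := ConHead.eq_of_whRed_of_whRed (.app v hd) (.app v' hd') h1 h1'
    cases this
    exact ⟨h2, h3⟩
  exact .inr ⟨ht, d, v, h1, hd, fun i => (key i).1, fun i => (key i).2⟩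

/-- Semantic content of the rule that makes data act as functions. It needs `D` to be a data type:
outside `bot`, `t` must evaluate to a constructor-headed term. -/
theorem app_mem_app_interp {D T : Ty C} (hD : IsData D) {ρ : Env C} (hρ : ρ.Valid) {t v : Tm C}
    (ht : t ∈ D.interp ρ) (hv : v ∈ T.interp ρ) : t.app v ∈ (Ty.app D T).interp ρ := by
  have hc := hD.isCand hρ
  have hv' := (T.saturated_interp hρ).sn v hv
  by_cases hb : t ∈ bot
  · exact .inl (app_mem_bot hb hv')
  · obtain ⟨d, hd, h⟩ := hc.2 rfl t ht hb
    have ht' := hc.1.sn t ht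
    exact .inr ⟨SN.app_of_whRed h ht' hv' (hd.sn_app (ht'.red h.lRed) hv'), d, v, WhRed.app h v,
      hd, hc.1.whRed h ht, hv⟩

theorem Sub.interp_subset {T U : Ty C} (h : Sub T U) {ρ : Env C} (hρ : ρ.Valid) :
    T.interp ρ ⊆ U.interp ρ := by
  induction h generalizing ρ with
  | refl => exact subset_rfl
  | trans _ _ ih1 ih2 => exact (ih1 hρ).trans (ih2 hρ)
  | arrow _ _ ih1 ih2 => exact fun t h v hv => ih2 hρ (h v (ih1 hρ hv))
  | app _ _ _ _ ih1 ih2 => exact Ty.app_interp_mono (ih1 hρ) (ih2 hρ)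
  | unionIntroL => exact Set.subset_union_left
  | unionIntroR => exact Set.subset_union_right
  | unionElim _ _ ih1 ih2 => exact Set.union_subset (ih1 hρ) (ih2 hρ)
  | interIntro _ _ ih1 ih2 => exact Set.subset_inter (ih1 hρ) (ih2 hρ)
  | interElimL => exact Set.inter_subset_left
  | interElimR => exact Set.inter_subset_right
  | allIntro k _ ih => exact fun t h A hA => ih (hρ.push hA) (by simpa using h)
  | allElim k _ hU =>
    intro t h
    rw [Ty.interp_inst]
    exact h _ (hU.isCand hρ)
  | exIntro k _ hU =>
    intro t h
    rw [Ty.interp_inst] at h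
    exact ⟨_, hU.isCand hρ, h⟩
  | exElim k _ ih => exact fun t ⟨A, hA, h⟩ => by simpa using ih (hρ.push hA) h
  | data hD _ => exact fun t h v hv => app_mem_app_interp hD hρ h hv
  | constr hne _ _ =>
    intro t h A hA
    rcases Ty.mem_interp_conApps h.1 with hb | ⟨vs, h1, _⟩
    · exact hA.1.bot_subset hb
    rcases Ty.mem_interp_conApps h.2 with hb | ⟨vs', h2, _⟩
    · exact hA.1.bot_subset hb
    -- Outside `bot` the term would have two values with different head constructors.
    exact absurd (foldl_app_con_inj (ConHead.eq_of_whRed_of_whRed (.foldl_con _ _)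
      (.foldl_con _ _) h1 h2)) hne
  | appInter n _ _ =>
    intro t h
    rcases mem_bot_or_of_forall_mem_app (Ty.mem_interp_bigInter.1 h) with
      h | ⟨h1, d, v, h2, hd, h3, h4⟩
    · exact .inl h
    · exact .inr ⟨h1, d, v, h2, hd, Ty.mem_interp_bigInter.2 h3, Ty.mem_interp_bigInter.2 h4⟩
  | @appAll k D T _ _ =>
    intro t h
    have : Nonempty {A : Set (Tm C) // IsCand k A} := ⟨⟨_, isCand_bot k⟩⟩
    rcases mem_bot_or_of_forall_mem_app (ι := {A : Set (Tm C) // IsCand k A})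
      (D := fun A => D.interp (ρ.push k A)) (T := fun A => T.interp (ρ.push k A))
      (fun A => h A.1 A.2) with h | ⟨h1, d, v, h2, hd, h3, h4⟩
    · exact .inl h
    · exact .inr ⟨h1, d, v, h2, hd, fun A hA => h3 ⟨A, hA⟩, fun A hA => h4 ⟨A, hA⟩⟩
  | arrowInter n _ _ =>
    exact fun t h v hv => Ty.mem_interp_bigInter.2 fun i =>
      Ty.mem_interp_bigInter.1 h i v (Ty.mem_interp_bigInter.1 hv i)
  | arrowAll k _ _ => exact fun t h v hv A hA => h A hA v (hv A hA)
  | arrowUnion n _ _ =>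
    intro t h v hv
    obtain ⟨i, hi⟩ := Ty.mem_interp_bigUnion.1 hv
    exact Ty.mem_interp_bigUnion.2 ⟨i, Ty.mem_interp_bigInter.1 h i v hi⟩
  | arrowEx k _ _ => exact fun t h v ⟨A, hA, hv⟩ => ⟨A, hA, h A hA v hv⟩
  | unionAppR n _ _ =>
    rintro t (h | ⟨h1, d, v, h2, hd, h3, h4⟩)
    · exact Ty.mem_interp_bigUnion.2 ⟨0, .inl h⟩
    · obtain ⟨i, hi⟩ := Ty.mem_interp_bigUnion.1 h4
      exact Ty.mem_interp_bigUnion.2 ⟨i, .inr ⟨h1, d, v, h2, hd, h3, hi⟩⟩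
  | unionAppL n _ _ =>
    rintro t (h | ⟨h1, d, v, h2, hd, h3, h4⟩)
    · exact Ty.mem_interp_bigUnion.2 ⟨0, .inl h⟩
    · obtain ⟨i, hi⟩ := Ty.mem_interp_bigUnion.1 h3
      exact Ty.mem_interp_bigUnion.2 ⟨i, .inr ⟨h1, d, v, h2, hd, hi, h4⟩⟩
  | exAppR k _ _ =>
    rintro t (h | ⟨h1, d, v, h2, hd, h3, A, hA, h4⟩)
    · exact ⟨_, isCand_bot k, .inl h⟩
    · exact ⟨A, hA, .inr ⟨h1, d, v, h2, hd, by simpa using h3, h4⟩⟩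
  | exAppL k _ _ =>
    rintro t (h | ⟨h1, d, v, h2, hd, ⟨A, hA, h3⟩, h4⟩)
    · exact ⟨_, isCand_bot k, .inl h⟩
    · exact ⟨A, hA, .inr ⟨h1, d, v, h2, hd, h3, by simpa using h4⟩⟩
  | @unionAll k T U _ _ =>
    intro t h
    -- Classical: membership in `U` does not depend on the candidate, so it is decided before one is
    -- chosen.
    by_cases hU : t ∈ U.interp ρ
    · exact .inr hU
    · exact .inl fun A hA => (h A hA).resolve_right (by simpa using hU)
  | exInter k _ _ => exact fun t ⟨⟨A, hA, h⟩, hU⟩ => ⟨A, hA, h, by simpa using hU⟩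

/-! ### Soundness of typing -/

/-- A case binding is read as the function which performs the case analysis. -/
def Subject.toTm : Subject C → Tm C
  | tm t => t
  | cb s θ => .lam (.cas s (fun c => (θ c).lift) (.var 0))

/-- The substitution `σ` realises the context `Γ`. -/
def Ctx.Realised (Γ : Ctx C) (ρ : Env C) (σ : ℕ → Tm C) : Prop :=
  ∀ n T, Γ[n]? = some T → σ n ∈ T.interp ρ

theorem Ctx.realised_cons {Γ : Ctx C} {T : Ty C} {ρ : Env C} {σ : ℕ → Tm C} :
    Ctx.Realised (T :: Γ) ρ σ ↔ σ 0 ∈ T.interp ρ ∧ Γ.Realised ρ fun n => σ (n + 1) := by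
  refine ⟨fun h => ⟨h 0 T rfl, fun n U hU => h (n + 1) U hU⟩, fun ⟨h1, h2⟩ n U hU => ?_⟩
  cases n with
  | zero => simp at hU; exact hU ▸ h1
  | succ n => exact h2 n U hU

theorem Ctx.realised_append {Γ Δ : Ctx C} {ρ : Env C} {σ : ℕ → Tm C} :
    Ctx.Realised (Γ ++ Δ) ρ σ ↔ Γ.Realised ρ σ ∧ Δ.Realised ρ fun n => σ (n + Γ.length) := by
  induction Γ generalizing σ with
  | nil => exact ⟨fun h => ⟨nofun, h⟩, fun h => h.2⟩
  | cons T Γ ih =>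
    rw [List.cons_append, realised_cons, realised_cons, ih, and_assoc]
    rfl

theorem Ctx.realised_lift {Γ : Ctx C} {k : Kind} {A : Set (Tm C)} {ρ : Env C} {σ : ℕ → Tm C} :
    (Γ.lift k).Realised (ρ.push k A) σ ↔ Γ.Realised ρ σ := by
  simp [Ctx.Realised, Ctx.lift]

theorem Typed.mem_interp {Γ : Ctx C} {M : Subject C} {T : Ty C} (h : Typed Γ M T) {ρ : Env C}
    (hρ : ρ.Valid) {σ : ℕ → Tm C} (hσ : Γ.Realised ρ σ) : M.toTm.subst σ ∈ T.interp ρ := by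
  have cb_app (s : Finset C) (θ : {c // c ∈ s} → Tm C) (v : Tm C) (σ : ℕ → Tm C) :
      Wh (.app ((Subject.cb s θ).toTm.subst σ) v) (.cas s (fun c => (θ c).subst σ) v) := by
    have := Wh.appLam (.cas s (fun c => ((θ c).subst σ).lift) (.var 0)) v
    rw [Tm.cas_lift_inst fun c => (θ c).subst σ] at this
    simp only [Subject.toTm, Tm.subst, Tm.lift_subst_upSubst]
    exact this
  have cb_mem (s : Finset C) (θ : {c // c ∈ s} → Tm C) {v : Tm C} {σ : ℕ → Tm C}
      {A : Set (Tm C)} (hA : Saturated A) (hv : SN v)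
      (h : .cas s (fun c => (θ c).subst σ) v ∈ A) :
      .app ((Subject.cb s θ).toTm.subst σ) v ∈ A := by
    refine hA.exp _ _ (SN.appLam ?_ hv) (cb_app s θ v σ) h
    simp only [Tm.subst, Tm.lift_subst_upSubst]
    rw [Tm.cas_lift_inst (fun c => (θ c).subst σ)]
    exact hA.sn _ h
  induction h generalizing ρ σ with
  | @cb Γ s θ Us Ts c₀ _ ih =>
    intro v hv
    have hθ : SNB fun c => (θ c).subst σ :=
      SNB.of_forall fun c => (Ty.saturated_interp _ hρ).sn _ (ih c hρ hσ)
    have hT := (Ts c₀).saturated_interp hρ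
    have hv' := (Ty.saturated_interp _ hρ).sn v hv
    refine cb_mem s θ hT hv' ?_
    rcases Ty.mem_interp_conApps hv with hb | ⟨vs, h1, h2⟩
    · exact hT.bot_subset (cas_mem_bot hθ hb)
    · have h3 := Ty.foldl_app_mem_interp h2 (ih c₀ hρ hσ)
      -- The argument evaluates to `c₀` applied to `vs`, so the case construct on it evaluates to
      -- the branch applied to `vs`, which lies in `Ts c₀` by `h3`.
      have h4 := SN.cas_foldl_con hθ c₀ vs (hv'.red h1.lRed) (hT.sn _ h3)
      exact hT.cas_of_whRed hθ h1 hv' (hT.of_whRed h4.2 h4.1 h3)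
  | @cbBot Γ s θ Ts _ _ ih =>
    intro v hv A hA
    have hθ : SNB fun c => (θ c).subst σ :=
      SNB.of_forall fun c => (Ty.saturated_interp _ hρ).sn _ (ih c hρ hσ)
    -- The intersection of all data candidates is `bot`, on which a case construct never has to
    -- match a constructor.
    have hb : v ∈ bot := hv _ (isCand_bot _)
    exact cb_mem s θ hA.1 hb.1 (hA.1.bot_subset (cas_mem_bot hθ hb))
  | init _ hn => exact hσ _ _ hn
  | false => exact (Ty.saturated_interp _ hρ).bot_subset dai_mem_bot
  | constr c => exact .inr ⟨SN.con c, .refl⟩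
  | @arrowIntro Γ t T U _ ih =>
    intro v hv
    have h : (t.subst (Tm.upSubst σ)).inst v ∈ U.interp ρ := by
      rw [Tm.subst_upSubst_inst]
      exact ih hρ (Ctx.realised_cons.2 ⟨hv, hσ⟩)
    have hU := U.saturated_interp hρ
    exact hU.exp _ _ (SN.appLam (hU.sn _ h) ((T.saturated_interp hρ).sn v hv)) (.appLam _ _) h
  | arrowElim _ _ ih1 ih2 => exact ih1 hρ hσ _ (ih2 hρ hσ)
  | @case Γ t s θ T T' Us h1 h2 ih1 ih2 =>
    -- Induction on `Us`: the case construct is applied to `w v`, and one weak head CaseApp step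
    -- moves `v` outside. That this step is weak head for every `w` is what the strategy was
    -- designed for.
    have key : ∀ w, w ∈ (Ty.arrows Us T).interp ρ →
        .cas s (fun c => (θ c).subst σ) w ∈ (Ty.arrows Us T').interp ρ := by
      have hθ := ih2 hρ hσ
      clear ih1 ih2 h1 h2
      induction Us with
      | nil => exact fun w hw => (T'.saturated_interp hρ).red _ _ (hθ w hw) (cb_app s θ w σ)
      | cons U Us ih =>
        exact fun w hw v hv => (Ty.saturated_interp _ hρ).red _ _ (ih _ (hw v hv))
          (.caseApp _ _ _ _)
    exact key _ (ih1 hρ hσ)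
  | univ k _ ih => exact fun A hA => ih (hρ.push hA) (Ctx.realised_lift.2 hσ)
  | inter _ _ ih1 ih2 => exact ⟨ih1 hρ hσ, ih2 hρ hσ⟩
  | exist k _ ih =>
    obtain ⟨h1, h2⟩ := Ctx.realised_append.1 hσ
    obtain ⟨⟨A, hA, h2⟩, h3⟩ := Ctx.realised_cons.1 h2
    have := ih (hρ.push hA) (σ := σ) (Ctx.realised_append.2 ⟨Ctx.realised_lift.2 h1,
      Ctx.realised_cons.2 ⟨by simpa [Ctx.lift] using h2,
        Ctx.realised_lift.2 (by simpa [Ctx.lift] using h3)⟩⟩)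
    simpa using this
  | union _ _ ih1 ih2 =>
    obtain ⟨h1, h2⟩ := Ctx.realised_append.1 hσ
    obtain ⟨h2, h3⟩ := Ctx.realised_cons.1 h2
    rcases h2 with h2 | h2
    · exact ih1 hρ (Ctx.realised_append.2 ⟨h1, Ctx.realised_cons.2 ⟨h2, h3⟩⟩)
    · exact ih2 hρ (Ctx.realised_append.2 ⟨h1, Ctx.realised_cons.2 ⟨h2, h3⟩⟩)
  | subs _ hs ih => exact hs.interp_subset hρ (ih hρ hσ)

/-! ### From strong normalisation to perfect normalisation -/

theorem Step.lStep {t t' : Tm C} (h : Step t t') : LStep t t' := by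
  induction h with
  | appLam t v => exact .appLam t v
  | appDai v => exact .appDai v
  | lamApp t => exact .lamApp t
  | lamDai => exact .lamDai
  | caseCons s θ c => exact .caseCons s θ c.1 c.2
  | caseDai s θ => exact .caseDai s θ
  | caseApp s θ t v => exact .caseApp s θ t v
  | caseLam s θ t => exact .caseLam s θ t
  | lamCongr _ ih => exact .lamCongr ih
  | appCongrLeft v _ ih => exact .appLeft v ih
  | appCongrRight t _ ih => exact .appRight t ih
  | caseCongrArg s θ _ ih => exact .caseArg s θ ih
  | caseCongrBranch s θ θ' t c _ h ih => exact .caseBranch s θ θ' t c ih h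

theorem Subterm.lStep_self {r t : Tm C} (h : Subterm r t) (hr : LStep r r) : LStep t t := by
  induction h with
  | refl => exact hr
  | lam _ ih => exact .lamCongr ih
  | appLeft v _ ih => exact .appLeft v ih
  | appRight t _ ih => exact .appRight t ih
  | caseArg s θ _ ih => exact .caseArg s θ ih
  | caseBranch s θ t c _ ih => exact .caseBranch s θ θ t c ih fun _ _ => rfl

theorem SN.not_lStep_self {t : Tm C} (h : SN t) : ¬ LStep t t := by
  induction h with
  | intro t _ ih => exact fun hs => ih t hs hs

theorem SN.perfectlyNormalising {t : Tm C} (h : SN t) : PerfectlyNormalising t := by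
  refine ⟨?_, fun v hv s θ c hc => ?_⟩
  · rintro ⟨f, h0, hf⟩
    induction h generalizing f with
    | intro t _ ih =>
      exact ih (f 1) (h0 ▸ (hf 0).lStep) (fun n => f (n + 1)) rfl fun n => hf (n + 1)
  · by_contra hcs
    have hv' : LRed t v := ReflTransGen.mono (fun _ _ => Step.lStep) _ _ hv
    exact (h.red hv').not_lStep_self (hc.lStep_self (.caseFail s θ c hcs))

end LamC

theorem mainTheorem1 {C : Type*} (Γ : LamC.Ctx C) (t : LamC.Tm C) (T : LamC.Ty C)
    (h : LamC.Typed Γ (.tm t) T) : LamC.PerfectlyNormalising t := by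
  -- Any valid valuation would do. Variables belong to `bot`, hence to every interpretation, so the
  -- identity substitution realises the context.
  have hρ : LamC.Env.Valid (fun _ _ => LamC.bot : LamC.Env C) := fun k _ => LamC.isCand_bot k
  have ht := h.mem_interp hρ (σ := LamC.Tm.var) fun n U _ =>
    (U.saturated_interp hρ).bot_subset (LamC.var_mem_bot n)
  rw [LamC.Tm.subst_var] at ht
  exact ((T.saturated_interp hρ).sn _ ht).perfectlyNormalising
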